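/- Let $1/2<q<1$, let $\mu=(\mu_j)_{j\ge 0}$ be a probability distribution on $\{0,1,2,\dots\}$ with $\mu_0+\mu_1<1$, let $\mathcal T$ be a plane Bienaymé–Galton–Watson tree with offspring distribution $\sum_{j\ge 0}q^j(1-q)\delta_j$, and, independently of $\mathcal T$, let i.i.d. numbers of cars $A_u$ with law $\mu$ arrive on its vertices $u$. Each vertex can accommodate one car. Each car parks on its arrival vertex if this is free, and otherwise drives towards the root and parks on the first free vertex it meets; if there is none, it leaves the tree. If $X_n$ denotes the number of cars visiting the root when the cars arriving on the vertices of height at most $n$ are parked, layer by layer, then $X=\lim_n X_n\in\{0,1,\dots,\infty\}$ (a non-decreasing limit) is the number of cars visiting the root of $\mathcal T$; the numbers of cars visiting the other vertices are defined in the same way, and a vertex is occupied if it is visited by at least one car. If the root is occupied, the root cluster $\mathcal C(\varnothing)$ is the connected component of the root in the set of occupied vertices, seen as a plane tree decorated with the car arrivals on its vertices. The process is subcritical if $\mathbb E[X]<\infty$. Put $p_\circ=\mathbb P(X=0)$. A fully parked tree is a finite plane tree $\mathbf t$ decorated with numbers $a_v\ge 0$ of cars arriving on its vertices $v$, such that all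 its vertices are occupied after parking. Let $\mathbb T_n^{(k)}$ be the set of fully parked trees with $n$ vertices and $k$ outgoing cars, let $w(\mathbf t)=\prod_{v\in\mathbf t}\mu_{a_v}$, and, for $x\ge 0$, let $$F(x,y)=\sum_{k\ge 0}\Big(\sum_{n\ge 1}\sum_{\mathbf t\in\mathbb T_n^{(k)}}w(\mathbf t)\,x^n\Big)y^k$$ as a formal power series in $y$ with coefficients $[y^k]F(x,y)\in[0,\infty]$. If $[y^k]F(x,y)$ is finite and non-zero, a random fully parked tree $\mathcal F$ with $k$ outgoing cars has the $x$-Boltzmann law if $\mathbb P(\mathcal F=\mathbf t)=x^n w(\mathbf t)/[y^k]F(x,y)$ for all $n$ and all $\mathbf t\in\mathbb T_n^{(k)}$. Suppose that the process is subcritical, and put $x_\circ=\dfrac{q(1-q)}{(1-qp_\circ)^2}$. Then, for every $k\ge 0$, $$\mathbb P(X=k+1)=\frac{1-qp_\circ}{q}\,[y^k]F(x_\circ,y),$$ this number is positive (and $[y^k]F(x_\circ,y)$ is finite), and, conditionally on $X=k+1$, the root cluster $\mathcal C(\varnothing)$ is almost surely a (finite) fully parked tree with $k$ outgoing cars, and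 has the $x_\circ$-Boltzmann law. -/

import Mathlib

open MeasureTheory ProbabilityTheory
open scoped ENNReal

namespace Parking

/-- Vertices of plane trees as words of integers, the last letter being the head of the list:
`[]` is the root, `i :: u` is the `i`-th child of `u` (starting from `0`), and the height of a
vertex is its length. -/
abbrev Vertex := List ℕ

/-- The vertices of the plane tree in which the vertex `u` has `N u` children. -/
def IsVertex (N : Vertex → ℕ) : Vertex → Prop
  | [] => True
  | i :: u => i < N u ∧ IsVertex N u

/-- The list of the vertices of height `n`. -/
def layer (N : Vertex → ℕ) : ℕ → List Vertex
  | 0 => [[]]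
  | n + 1 => (layer N n).flatMap fun u => (List.range (N u)).map fun i => i :: u

/-- The cars arriving on the vertices of height `n`, each recorded by its arrival vertex; `A u`
cars arrive on `u`. -/
def layerCars (N A : Vertex → ℕ) (n : ℕ) : List Vertex :=
  (layer N n).flatMap fun u => List.replicate (A u) u

/-- One more car reaches the vertex `u`. The current configuration is recorded by the number `c v`
of cars which have visited each vertex `v` so far (the vertices on which a car parks included), so
that the spot `v` is free iff `c v = 0`. The car parks on `u` if `u` is free, and
otherwise drives on to the parent of `u`, or leaves the tree if `u` is the root. -/
def drive (c : Vertex → ℕ) : Vertex → (Vertex → ℕ)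
  | [] => Function.update c [] (c [] + 1)
  | i :: u =>
      if c (i :: u) = 0 then Function.update c (i :: u) 1
      else drive (Function.update c (i :: u) (c (i :: u) + 1)) u

/-- Number of cars which visit each vertex when the cars arriving on the tree cut above height `n`
are parked one after the other, layer by layer. -/
def visitsUpTo (N A : Vertex → ℕ) : ℕ → (Vertex → ℕ)
  | 0 => (layerCars N A 0).foldl drive fun _ => 0
  | n + 1 => (layerCars N A (n + 1)).foldl drive (visitsUpTo N A n)

/-- Number of cars visiting the vertex `u` in the final configuration, possibly infinite: the
(non-decreasing) limit of the numbers for the tree cut above height `n`. -/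
noncomputable def visits (N A : Vertex → ℕ) (u : Vertex) : ℕ∞ :=
  ⨆ n, (visitsUpTo N A n u : ℕ∞)

/-- Vertices of the black cluster of the root: the vertices of the tree which are occupied, and
whose ancestors are all occupied, in the final configuration. -/
def rootClusterSet (N A : Vertex → ℕ) : Set Vertex :=
  {u | IsVertex N u ∧ ∀ v, v <:+ u → 1 ≤ visits N A v}

/-- Finite plane trees whose vertices carry a number of arriving cars. -/
inductive CarTree : Type
  | node (cars : ℕ) (children : List CarTree) : CarTree

/-- Number of arriving cars at the root. -/
def CarTree.cars : CarTree → ℕ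
  | .node a _ => a

/-- The subtrees of the root, from left to right. -/
def CarTree.children : CarTree → List CarTree
  | .node _ cs => cs

/-- Number of vertices. -/
def CarTree.size : CarTree → ℕ
  | .node _ cs => 1 + (cs.map CarTree.size).sum

/-- The weight `w(t)`: the product of `μ a` over the numbers `a` of cars arriving on the vertices
of `t`. -/
noncomputable def CarTree.weight (μ : PMF ℕ) : CarTree → ℝ≥0∞
  | .node a cs => μ a * (cs.map (CarTree.weight μ)).prod

/-- The subtree of descendants of a vertex; `none` outside the tree. -/
def CarTree.sub (t : CarTree) : Vertex → Option CarTree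
  | [] => some t
  | i :: u => (t.sub u).bind fun s => s.children[i]?

/-- Number of children of a vertex. -/
def CarTree.offspring (t : CarTree) (u : Vertex) : ℕ :=
  ((t.sub u).map fun s => s.children.length).getD 0

/-- Number of cars arriving on a vertex. -/
def CarTree.arrivals (t : CarTree) (u : Vertex) : ℕ :=
  ((t.sub u).map CarTree.cars).getD 0

/-- The set of fully parked trees with `n` vertices and `k` outgoing cars: after parking, every
vertex is occupied, and `k` of the cars visiting the root leave the tree. -/
def fullyParked (n k : ℕ) : Set CarTree :=
  {t | t.size = n ∧
    (∀ u, IsVertex t.offspring u → 1 ≤ visits t.offspring t.arrivals u) ∧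
    visits t.offspring t.arrivals [] - 1 = k}

/-- For `x ≥ 0`, the formal power series `y ↦ F(x, y)`, with coefficients in `[0, ∞]`. The term
`n = 0` vanishes as a tree has at least one vertex. -/
noncomputable def F (μ : PMF ℕ) (x : ℝ≥0∞) : PowerSeries ℝ≥0∞ :=
  PowerSeries.mk fun k => ∑' n : ℕ, ∑' t : fullyParked n k, (t : CarTree).weight μ * x ^ n

open Classical in
/-- The cluster of occupied descendants of an occupied vertex `u`, as a plane tree with its car
arrivals, cut `h` generations below `u`. -/
noncomputable def clusterUpTo (N A : Vertex → ℕ) : ℕ → Vertex → CarTree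
  | 0, u => .node (A u) []
  | h + 1, u => .node (A u)
      (((List.range (N u)).filter fun i => 1 ≤ visits N A (i :: u)).map
        fun i => clusterUpTo N A h (i :: u))

open Classical in
/-- The black cluster of the root, as a finite plane tree with its car arrivals (the
order among siblings is inherited); `none` if it is empty or infinite. A cluster
with `m` vertices has height less than `m`, hence it is not affected by the cut. -/
noncomputable def rootCluster (N A : Vertex → ℕ) : Option CarTree :=
  if (rootClusterSet N A).Nonempty ∧ (rootClusterSet N A).Finite then
    some (clusterUpTo N A (rootClusterSet N A).ncard [])
  else none

/-- The number `X` of cars visiting the root, for random offspring numbers and car arrivals. -/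
noncomputable def X {Ω : Type*} (N A : Vertex → Ω → ℕ) (ω : Ω) : ℕ∞ :=
  visits (fun u => N u ω) (fun u => A u ω) []

/-- The black cluster of the root, for random offspring numbers and car arrivals. -/
noncomputable def cluster {Ω : Type*} (N A : Vertex → Ω → ℕ) (ω : Ω) : Option CarTree :=
  rootCluster (fun u => N u ω) (fun u => A u ω)

/-- The parking process is subcritical: `X` has a finite expectation. -/
def IsSubcritical {Ω : Type*} [MeasurableSpace Ω] (P : Measure Ω) (N A : Vertex → Ω → ℕ) : Prop :=
  ∫⁻ ω, (X N A ω : ℝ≥0∞) ∂P < ∞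

/-- Under the probability measure `P`, the random tree `T` is almost surely a (finite) fully parked
tree with `k` outgoing cars, and it has the `x`-Boltzmann law. -/
structure IsBoltzmann {Ω : Type*} [MeasurableSpace Ω] (P : Measure Ω) (T : Ω → Option CarTree)
    (μ : PMF ℕ) (k : ℕ) (x : ℝ≥0∞) : Prop where
  isProbabilityMeasure : IsProbabilityMeasure P
  measurableSet_eq : ∀ t : CarTree, MeasurableSet {ω | T ω = some t}
  coeff_ne_top : PowerSeries.coeff k (F μ x) ≠ ∞
  ae_fullyParked : ∀ᵐ ω ∂P, ∃ n, ∃ t ∈ fullyParked n k, T ω = some t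
  law : ∀ n, ∀ t ∈ fullyParked n k,
    P {ω | T ω = some t} = (PowerSeries.coeff k (F μ x))⁻¹ * x ^ n * t.weight μ

end Parking

namespace Parking

/-! The core is a formula for single trees: for every finite full tree t, the root cluster equals t
with probability K x^|t| w(t), where K = (1 - qp)/q (`IsModel.measure_isCluster`). Whether a vertex
is occupied depends only on its own subtree, so the children of a vertex carry independent copies of
the whole picture: each is unoccupied with probability p, or has a prescribed cluster c with
probability f(c). Summing over the geometric number of children and the positions of the occupied
ones gives (1 - q)/(1 - qp) times the product of the q f(c)/(1 - qp) (`tsum_slotSum`). With f(c) = K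
x^|c| w(c), the induction on the tree closes if qK/(1 - qp) = 1 and Kx = (1 - q)/(1 - qp), which
gives the values of K and x. Summing over the full trees with k outgoing cars yields the law of X,
and conditioning yields the Boltzmann law, provided that the root cluster is almost surely finite.

Finiteness comes from subcriticality. Let X_m be the number of cars visiting the root of the tree
cut at height m, and Z_m the number of vertices of height m joined to the root by occupied vertices
in that cut tree. A car overflowing from the next generation into such a vertex runs down to the
root, hence E X_(m+1) - E X_m ≥ q μ[2,∞) E Z_m. As E X is finite, the E Z_m are summable, so almost
surely Z_m vanishes eventually (`IsModel.ae_not_hasPath`); then later generations add nothing to the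
cluster (`stable_of_not_hasPath`).

The coefficient is positive because cars can both overflow and be absorbed. Absorption requires μ 0
≠ 0: otherwise Z_m would count the whole generation m, with mean at least one since q > 1/2.

All this works with a recursion on cut trees, to which the car-by-car dynamics is reduced by a flux
balance that each new car preserves (`visitsUpTo_length_add`). -/

/-! ### Parking as a recursion on cut trees -/

/-- Number of cars visiting `u` when the subtree of `u` is cut `m` generations below `u`. -/
def cutVisits (N A : Vertex → ℕ) : ℕ → Vertex → ℕ
  | 0, u => A u
  | m + 1, u => A u + ∑ i ∈ Finset.range (N u), (cutVisits N A m (i :: u) - 1)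

theorem le_cutVisits (N A : Vertex → ℕ) (m : ℕ) (u : Vertex) : A u ≤ cutVisits N A m u := by
  cases m <;> simp [cutVisits]

theorem cutVisits_le_succ (N A : Vertex → ℕ) (m : ℕ) (u : Vertex) :
    cutVisits N A m u ≤ cutVisits N A (m + 1) u := by
  induction m generalizing u with
  | zero => exact le_cutVisits N A 1 u
  | succ m ih =>
    rw [cutVisits, cutVisits]
    gcongr with i
    exact ih _

theorem cutVisits_mono (N A : Vertex → ℕ) (u : Vertex) : Monotone fun m => cutVisits N A m u :=
  monotone_nat_of_le_succ fun m => cutVisits_le_succ N A m u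

theorem cutVisits_append (N A : Vertex → ℕ) (m : ℕ) (u v : Vertex) :
    cutVisits N A m (v ++ u) =
      cutVisits (fun w => N (w ++ u)) (fun w => A (w ++ u)) m v := by
  induction m generalizing v with
  | zero => rfl
  | succ m ih => simp only [cutVisits, ← ih, List.cons_append]

/-- The configuration `c` results from the arrival of `a u` cars on each vertex `u`: the cars
visiting `u` either arrived there, or come from a child of `u` which was already full. -/
structure IsBalanced (N : Vertex → ℕ) (c : Vertex → ℕ) (a : Vertex → ℤ) : Prop where
  eq_zero : ∀ u, ¬ IsVertex N u → c u = 0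
  eq_add_sum : ∀ u, (c u : ℤ) = a u + ∑ i ∈ Finset.range (N u), ((c (i :: u) - 1 : ℕ) : ℤ)

/-- A car that parks adds a visit but no outflow, since `0 - 1` and `1 - 1` agree in ℕ; a car that
drives on adds a visit and one unit of outflow to the parent. -/
theorem IsBalanced.drive {N c : Vertex → ℕ} {a : Vertex → ℤ} {v : Vertex}
    (h : IsBalanced N c a) (hv : IsVertex N v) :
    IsBalanced N (drive c v) (a + Pi.single v 1) := by
  induction v generalizing c a with
  | nil =>
    refine ⟨fun u hu => ?_, fun u => ?_⟩
    · have : u ≠ [] := by rintro rfl; exact hu hv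
      simp [Parking.drive, this, h.eq_zero u hu]
    · have := h.eq_add_sum u
      by_cases hu : u = []
      · subst hu
        simp [Parking.drive] at this ⊢
        rw [this]; ring
      · simp [Parking.drive, hu] at this ⊢
        exact this
  | cons i u ih =>
    by_cases h0 : c (i :: u) = 0
    · simp only [Parking.drive, h0, if_true]
      refine ⟨fun w hw => ?_, fun w => ?_⟩
      · have : w ≠ i :: u := by rintro rfl; exact hw hv
        simp [this, h.eq_zero w hw]
      · have key : ∀ j, Function.update c (i :: u) 1 (j :: w) - 1 = c (j :: w) - 1 := by
          intro j
          by_cases hj : j :: w = i :: u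
          · rw [hj, h0]; simp
          · rw [Function.update_of_ne hj]
        simp only [key, Pi.add_apply]
        have := h.eq_add_sum w
        by_cases hw : w = i :: u
        · subst hw
          rw [h0] at this
          simp only [Function.update_self, Pi.single_eq_same]
          push_cast at this ⊢
          linarith
        · rw [Function.update_of_ne hw, Pi.single_eq_of_ne hw, this]; ring
    · simp only [Parking.drive, h0, if_false]
      -- Midway, the car has left `i :: u` but is not yet counted at `u`: this is a balance with a
      -- debt of one arrival at `u`, repaid by the induction hypothesis. Hence the integer-valued
      -- arrivals.
      have hc : IsBalanced N (Function.update c (i :: u) (c (i :: u) + 1))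
          (a + Pi.single (i :: u) 1 - Pi.single u 1) := by
        refine ⟨fun w hw => ?_, fun w => ?_⟩
        · have : w ≠ i :: u := by rintro rfl; exact hw hv
          simp [this, h.eq_zero w hw]
        · have key : ∑ j ∈ Finset.range (N w),
              ((Function.update c (i :: u) (c (i :: u) + 1) (j :: w) - 1 : ℕ) : ℤ) =
              ∑ j ∈ Finset.range (N w), ((c (j :: w) - 1 : ℕ) : ℤ)
                + (Pi.single u 1 : Vertex → ℤ) w := by
            by_cases hw : w = u
            · subst hw
              rw [Pi.single_eq_same, ← Finset.add_sum_erase _ _ (Finset.mem_range.2 hv.1),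
                ← Finset.add_sum_erase (Finset.range (N w)) (fun j => ((c (j :: w) - 1 : ℕ) : ℤ))
                  (Finset.mem_range.2 hv.1)]
              rw [Finset.sum_congr rfl (g := fun j => ((c (j :: w) - 1 : ℕ) : ℤ))]
              · simp only [Function.update_self]
                have : 1 ≤ c (i :: w) := Nat.one_le_iff_ne_zero.2 h0
                push_cast [this]
                ring
              · intro j hj
                rw [Function.update_of_ne]
                simpa using Finset.ne_of_mem_erase hj
            · rw [Pi.single_eq_of_ne hw, add_zero]
              refine Finset.sum_congr rfl fun j _ => ?_
              rw [Function.update_of_ne]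
              simp [hw]
          rw [key]
          have := h.eq_add_sum w
          simp only [Pi.add_apply, Pi.sub_apply]
          by_cases hw : w = i :: u
          · subst hw
            simp only [Function.update_self, Pi.single_eq_same]
            push_cast
            rw [this]; ring
          · rw [Function.update_of_ne hw, Pi.single_eq_of_ne hw, this]; ring
      simpa using ih hc hv.2

theorem IsBalanced.foldl {N c : Vertex → ℕ} {a : Vertex → ℤ} {l : List Vertex}
    (h : IsBalanced N c a) (hl : ∀ v ∈ l, IsVertex N v) :
    IsBalanced N (l.foldl Parking.drive c) (a + fun v => (l.count v : ℤ)) := by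
  induction l generalizing c a with
  | nil => simpa [Pi.add_def] using h
  | cons v l ih =>
    rw [List.foldl_cons]
    convert ih (h.drive (hl v (by simp))) (fun w hw => hl w (by simp [hw])) using 1
    ext w
    simp only [Pi.add_apply, List.count_cons, Pi.single_apply]
    by_cases hw : v = w
    · simp [hw]; ring
    · simp [hw, Ne.symm hw]

theorem drive_of_length_lt {c : Vertex → ℕ} {v w : Vertex} (h : v.length < w.length) :
    drive c v w = c w := by
  induction v generalizing c with
  | nil =>
    have : w ≠ [] := by rintro rfl; simp at h
    simp [drive, this]
  | cons i u ih =>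
    have hw : w ≠ i :: u := by rintro rfl; simp at h
    rw [drive]
    split_ifs with h0
    · simp [hw]
    · rw [ih (by simp at h; omega)]; simp [hw]

theorem foldl_drive_of_length_lt {c : Vertex → ℕ} {l : List Vertex} {w : Vertex}
    (h : ∀ v ∈ l, v.length < w.length) : l.foldl drive c w = c w := by
  induction l generalizing c with
  | nil => rfl
  | cons v l ih =>
    rw [List.foldl_cons, ih fun v hv => h v (by simp [hv]), drive_of_length_lt (h v (by simp))]

theorem mem_layer {N : Vertex → ℕ} {n : ℕ} {v : Vertex} :
    v ∈ layer N n ↔ IsVertex N v ∧ v.length = n := by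
  induction n generalizing v with
  | zero =>
    cases v <;> simp [layer, IsVertex]
  | succ n ih =>
    cases v with
    | nil => simp [layer]
    | cons i u =>
      simp only [layer, List.mem_flatMap, ih, List.mem_map, List.mem_range, List.cons.injEq,
        IsVertex, List.length_cons, Nat.add_right_cancel_iff]
      constructor
      · rintro ⟨w, hw, j, hj, rfl, rfl⟩; exact ⟨⟨hj, hw.1⟩, hw.2⟩
      · rintro ⟨⟨hi, hu⟩, hl⟩; exact ⟨u, ⟨hu, hl⟩, i, hi, rfl, rfl⟩

theorem nodup_layer (N : Vertex → ℕ) (n : ℕ) : (layer N n).Nodup := by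
  induction n with
  | zero => simp [layer]
  | succ n ih =>
    rw [layer, List.nodup_flatMap]
    refine ⟨fun u _ => List.nodup_range.map fun i j h => by simpa using h, ?_⟩
    refine ih.imp fun {u v} huv => ?_
    simp only [Function.onFun, List.disjoint_left, List.mem_map, List.mem_range]
    rintro _ ⟨i, _, rfl⟩ ⟨j, _, h⟩
    simp only [List.cons.injEq] at h
    exact huv h.2.symm

theorem count_flatMap_replicate (f : Vertex → ℕ) (v : Vertex) (l : List Vertex)
    (hl : l.Nodup) :
    (l.flatMap fun u => List.replicate (f u) u).count v = if v ∈ l then f v else 0 := by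
  induction l with
  | nil => simp
  | cons u l ih =>
    rw [List.nodup_cons] at hl
    rw [List.flatMap_cons, List.count_append, ih hl.2, List.count_replicate]
    by_cases h : u = v
    · subst h; simp [hl.1]
    · simp [h, Ne.symm h]

theorem mem_layerCars {N A : Vertex → ℕ} {n : ℕ} {v : Vertex} (h : v ∈ layerCars N A n) :
    v ∈ layer N n := by
  rw [layerCars, List.mem_flatMap] at h
  obtain ⟨u, hu, hv⟩ := h
  rw [List.eq_of_mem_replicate hv]; exact hu

theorem visitsUpTo_of_length_lt (N A : Vertex → ℕ) {n : ℕ} {w : Vertex} (h : n < w.length) :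
    visitsUpTo N A n w = 0 := by
  induction n with
  | zero =>
    rw [visitsUpTo, foldl_drive_of_length_lt]
    intro v hv
    rw [(mem_layer.1 (mem_layerCars hv)).2]; exact h
  | succ n ih =>
    rw [visitsUpTo, foldl_drive_of_length_lt]
    · exact ih (by omega)
    · intro v hv
      rw [(mem_layer.1 (mem_layerCars hv)).2]; exact h

theorem isBalanced_visitsUpTo (N A : Vertex → ℕ) (n : ℕ) :
    IsBalanced N (visitsUpTo N A n)
      (fun v => ∑ m ∈ Finset.range (n + 1), ((layerCars N A m).count v : ℤ)) := by
  induction n with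
  | zero =>
    have h0 : IsBalanced N (fun _ => 0) (fun _ => 0) := ⟨fun _ _ => rfl, fun u => by simp⟩
    have h := h0.foldl (l := layerCars N A 0) fun v hv => (mem_layer.1 (mem_layerCars hv)).1
    refine ⟨h.eq_zero, fun u => ?_⟩
    simpa only [visitsUpTo, zero_add, Finset.sum_range_one, Pi.add_apply] using h.eq_add_sum u
  | succ n ih =>
    have h := ih.foldl (l := layerCars N A (n + 1))
      fun v hv => (mem_layer.1 (mem_layerCars hv)).1
    refine ⟨h.eq_zero, fun u => ?_⟩
    rw [Finset.sum_range_succ]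
    exact h.eq_add_sum u

/-- The balance determines the configuration from the bottom layer upwards, because nothing is
visited below the cut; the order in which the cars arrive is thereby forgotten. -/
theorem visitsUpTo_length_add (N A : Vertex → ℕ) (m : ℕ) {u : Vertex} (hu : IsVertex N u) :
    visitsUpTo N A (u.length + m) u = cutVisits N A m u := by
  -- The cut height is frozen as `n`: passing to a child increases the length and decreases `m`.
  obtain ⟨n, hn⟩ : ∃ n, n = u.length + m := ⟨_, rfl⟩
  rw [← hn]
  have hA : ∀ v, IsVertex N v → v.length ≤ n →
      ∑ m ∈ Finset.range (n + 1), ((layerCars N A m).count v : ℤ) = A v := by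
    intro v hv hvn
    rw [Finset.sum_eq_single v.length]
    · rw [layerCars, count_flatMap_replicate _ _ _ (nodup_layer N _),
        if_pos (mem_layer.2 ⟨hv, rfl⟩)]
    · intro j _ hj
      rw [layerCars, count_flatMap_replicate _ _ _ (nodup_layer N _), if_neg]
      · rfl
      · rw [mem_layer]; rintro ⟨_, h⟩; exact hj h.symm
    · intro h; simp at h; omega
  induction m generalizing u with
  | zero =>
    have h := (isBalanced_visitsUpTo N A n).eq_add_sum u
    rw [hA u hu (by omega), Finset.sum_eq_zero] at h
    · rw [cutVisits]; simpa using h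
    · intro i _
      rw [visitsUpTo_of_length_lt]
      · rfl
      · simp; omega
  | succ m ih =>
    have h := (isBalanced_visitsUpTo N A n).eq_add_sum u
    rw [hA u hu (by omega)] at h
    rw [cutVisits]
    rw [Finset.sum_congr rfl fun i hi => by
      rw [ih (u := i :: u) ⟨Finset.mem_range.1 hi, hu⟩ (by simp; omega)]] at h
    exact_mod_cast h

theorem visits_eq_iSup (N A : Vertex → ℕ) {u : Vertex} (hu : IsVertex N u) :
    visits N A u = ⨆ m, (cutVisits N A m u : ℕ∞) := by
  apply le_antisymm
  · refine iSup_le fun n => ?_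
    rcases lt_or_ge n u.length with h | h
    · rw [visitsUpTo_of_length_lt N A h]; simp
    · obtain ⟨m, rfl⟩ := Nat.exists_eq_add_of_le h
      rw [visitsUpTo_length_add N A m hu]
      exact le_iSup (fun m => (cutVisits N A m u : ℕ∞)) m
  · refine iSup_le fun m => ?_
    rw [← visitsUpTo_length_add N A m hu]
    exact le_iSup (fun n => (visitsUpTo N A n u : ℕ∞)) _

/-- Some car visits the vertex `u` when the subtree of `u` is parked. -/
def IsOccupied (N A : Vertex → ℕ) (u : Vertex) : Prop := ∃ m, 1 ≤ cutVisits N A m u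

theorem one_le_visits_iff (N A : Vertex → ℕ) {u : Vertex} (hu : IsVertex N u) :
    1 ≤ visits N A u ↔ IsOccupied N A u := by
  rw [visits_eq_iSup N A hu, Order.one_le_iff_ne_zero, ne_eq, ENat.iSup_eq_zero, IsOccupied]
  simp [Nat.one_le_iff_ne_zero]

theorem visits_eq_of_eventually (N A : Vertex → ℕ) {u : Vertex} (hu : IsVertex N u) {v : ℕ}
    (h : ∀ᶠ m in Filter.atTop, cutVisits N A m u = v) : visits N A u = v := by
  rw [visits_eq_iSup N A hu]
  obtain ⟨M, hM⟩ := Filter.eventually_atTop.1 h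
  apply le_antisymm
  · refine iSup_le fun m => ?_
    rw [← hM (max M m) (le_max_left _ _)]
    exact_mod_cast cutVisits_mono N A u (le_max_right M m)
  · rw [← hM M le_rfl]
    exact le_iSup (fun m => (cutVisits N A m u : ℕ∞)) M

/-! ### Finite decorated trees and full parking -/

theorem CarTree.induction {p : CarTree → Prop}
    (node : ∀ a cs, (∀ c ∈ cs, p c) → p (.node a cs)) : ∀ t, p t
  | .node a cs => node a cs fun c _ => CarTree.induction node c

/-- Number of cars visiting the root of a tree. -/
def CarTree.rootVisits : CarTree → ℕ
  | .node a cs => a + (cs.map fun c => c.rootVisits - 1).sum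

/-- All vertices are occupied after parking. -/
def CarTree.IsFull (t : CarTree) : Prop := ∀ u s, t.sub u = some s → 1 ≤ s.rootVisits

theorem CarTree.sub_append_singleton (a : ℕ) (cs : List CarTree) (u : Vertex) (i : ℕ) :
    (CarTree.node a cs).sub (u ++ [i]) = cs[i]?.bind fun c => c.sub u := by
  induction u with
  | nil => simp [CarTree.sub, CarTree.children]
  | cons j u ih =>
    rw [List.cons_append, CarTree.sub, ih, Option.bind_assoc]
    rfl

theorem CarTree.isFull_node {a : ℕ} {cs : List CarTree} :
    (CarTree.node a cs).IsFull ↔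
      1 ≤ (CarTree.node a cs).rootVisits ∧ ∀ c ∈ cs, c.IsFull := by
  constructor
  · refine fun h => ⟨h [] _ rfl, fun c hc u s hs => ?_⟩
    obtain ⟨i, hi, rfl⟩ := List.getElem_of_mem hc
    refine h (u ++ [i]) s ?_
    rw [CarTree.sub_append_singleton, List.getElem?_eq_getElem hi]
    exact hs
  · rintro ⟨h, hc⟩ u s hs
    induction u using List.reverseRecOn with
    | nil =>
      obtain rfl : CarTree.node a cs = s := by simpa [CarTree.sub] using hs
      exact h
    | append_singleton u i _ =>
      rw [CarTree.sub_append_singleton, Option.bind_eq_some_iff] at hs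
      obtain ⟨c, hic, hs⟩ := hs
      exact hc c (List.mem_of_getElem? hic) u s hs

theorem CarTree.IsFull.one_le {t : CarTree} (h : t.IsFull) : 1 ≤ t.rootVisits := h [] t rfl

theorem CarTree.isVertex_offspring (t : CarTree) (u : Vertex) :
    IsVertex t.offspring u ↔ ∃ s, t.sub u = some s := by
  induction u with
  | nil => simp [IsVertex, CarTree.sub]
  | cons i u ih =>
    rw [IsVertex, ih, CarTree.offspring, CarTree.sub]
    constructor
    · rintro ⟨h, s, hs⟩
      simp only [hs, Option.map_some, Option.getD_some] at h
      exact ⟨s.children[i], by simp [hs, h]⟩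
    · rintro ⟨c, hc⟩
      obtain ⟨s, hs, hc⟩ := Option.bind_eq_some_iff.1 hc
      refine ⟨?_, s, hs⟩
      simp only [hs, Option.map_some, Option.getD_some]
      exact (List.getElem?_eq_some_iff.1 hc).1

theorem sum_range_length_eq (cs : List CarTree) (f : ℕ → ℕ) (g : CarTree → ℕ)
    (h : ∀ i (hi : i < cs.length), f i = g cs[i]) :
    ∑ i ∈ Finset.range cs.length, f i = (cs.map g).sum := by
  induction cs generalizing f with
  | nil => simp
  | cons c cs ih =>
    rw [List.length_cons, Finset.sum_range_succ', ih (fun i => f (i + 1)), List.map_cons,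
      List.sum_cons, add_comm, h 0 (by simp)]
    · rfl
    · intro i hi
      exact h (i + 1) (by simpa using hi)

/-- Once the cut is deeper than the finite subtree `s`, the recursion for the cut tree is the
structural recursion on `s`. -/
theorem CarTree.eventually_cutVisits (t : CarTree) {u : Vertex} {s : CarTree}
    (h : t.sub u = some s) :
    ∀ᶠ m in Filter.atTop, cutVisits t.offspring t.arrivals m u = s.rootVisits := by
  induction s using CarTree.induction generalizing u with
  | node a cs ih =>
    have hN : t.offspring u = cs.length := by simp [CarTree.offspring, h, CarTree.children]
    have hA : t.arrivals u = a := by simp [CarTree.arrivals, h, CarTree.cars]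
    have key : ∀ᶠ m in Filter.atTop, ∀ i ∈ Finset.range cs.length,
        ∀ hi : i < cs.length,
          cutVisits t.offspring t.arrivals m (i :: u) = cs[i].rootVisits := by
      rw [Filter.eventually_all_finset]
      intro i hi
      rw [Finset.mem_range] at hi
      filter_upwards [ih cs[i] (List.getElem_mem hi) (u := i :: u)
        (by simp [CarTree.sub, h, CarTree.children, hi])] with m hm _ using hm
    rw [← Filter.map_add_atTop_eq_nat 1, Filter.eventually_map]
    filter_upwards [key] with m hm
    rw [cutVisits, hN, hA, CarTree.rootVisits, sum_range_length_eq cs _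
      (fun c => c.rootVisits - 1)]
    intro i hi
    rw [hm i (Finset.mem_range.2 hi) hi]

theorem mem_fullyParked {n k : ℕ} {t : CarTree} :
    t ∈ fullyParked n k ↔ t.size = n ∧ t.IsFull ∧ t.rootVisits = k + 1 := by
  have hv : ∀ u s, t.sub u = some s → visits t.offspring t.arrivals u = s.rootVisits :=
    fun u s hs => visits_eq_of_eventually _ _ ((t.isVertex_offspring u).2 ⟨s, hs⟩)
      (t.eventually_cutVisits hs)
  have hfull : (∀ u, IsVertex t.offspring u → 1 ≤ visits t.offspring t.arrivals u) ↔
      t.IsFull := by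
    constructor
    · intro h u s hs
      have := h u ((t.isVertex_offspring u).2 ⟨s, hs⟩)
      rw [hv u s hs] at this
      exact_mod_cast this
    · intro h u hu
      obtain ⟨s, hs⟩ := (t.isVertex_offspring u).1 hu
      rw [hv u s hs]
      exact_mod_cast h u s hs
  rw [fullyParked, Set.mem_ofPred_eq, hfull, hv [] t rfl]
  refine and_congr_right fun _ => and_congr_right fun h => ?_
  have := h.one_le
  norm_cast
  omega

/-! ### Clusters as limits of their truncations -/

open Classical in
/-- The occupied children of a vertex. -/
noncomputable def occupiedChildren (N A : Vertex → ℕ) (u : Vertex) : List ℕ :=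
  (List.range (N u)).filter fun i => IsOccupied N A (i :: u)

/-- The cluster of occupied descendants of `u`, cut `h` generations below `u`. -/
noncomputable def cutCluster (N A : Vertex → ℕ) : ℕ → Vertex → CarTree
  | 0, u => .node (A u) []
  | h + 1, u => .node (A u)
      ((occupiedChildren N A u).map fun i => cutCluster N A h (i :: u))

open Classical in
theorem clusterUpTo_eq_cutCluster (N A : Vertex → ℕ) (h : ℕ) {u : Vertex} (hu : IsVertex N u) :
    clusterUpTo N A h u = cutCluster N A h u := by
  induction h generalizing u with
  | zero => rfl
  | succ h ih =>
    rw [clusterUpTo, cutCluster, occupiedChildren]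
    congr 1
    rw [List.filter_congr (q := fun i => decide (IsOccupied N A (i :: u)))]
    · refine List.map_congr_left fun i hi => ih ⟨?_, hu⟩
      exact List.mem_range.1 (List.mem_of_mem_filter hi)
    · intro i hi
      rw [decide_eq_decide]
      exact one_le_visits_iff N A ⟨List.mem_range.1 hi, hu⟩

/-- The cluster of occupied descendants of `u` is the finite tree `t`. -/
def IsCluster (N A : Vertex → ℕ) (u : Vertex) (t : CarTree) : Prop :=
  ∀ᶠ h in Filter.atTop, cutCluster N A h u = t

theorem IsCluster.unique {N A : Vertex → ℕ} {u : Vertex} {s t : CarTree}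
    (hs : IsCluster N A u s) (ht : IsCluster N A u t) : s = t := by
  obtain ⟨h, h1, h2⟩ := (hs.and ht).exists
  exact h1.symm.trans h2

theorem eventually_map_eq_iff {α β : Type*} (f : ℕ → α → β) (l : List α) (cs : List β) :
    (∀ᶠ h in Filter.atTop, l.map (f h) = cs) ↔
      List.Forall₂ (fun i c => ∀ᶠ h in Filter.atTop, f h i = c) l cs := by
  induction l generalizing cs with
  | nil => cases cs <;> simp [-Filter.eventually_atTop, Filter.atTop_neBot.ne]
  | cons i l ih =>
    cases cs with
    | nil => simp [-Filter.eventually_atTop, Filter.atTop_neBot.ne]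
    | cons c cs => simp [← ih, Filter.eventually_and, -Filter.eventually_atTop]

theorem exists_of_forall₂_of_mem_left {α β : Type*} {R : α → β → Prop} {l : List α}
    {cs : List β} (h : List.Forall₂ R l cs) {i : α} (hi : i ∈ l) : ∃ c ∈ cs, R i c := by
  induction h with
  | nil => simp at hi
  | cons hic _ ih =>
    rcases List.mem_cons.1 hi with rfl | hi
    · exact ⟨_, by simp, hic⟩
    · obtain ⟨c, hc, h⟩ := ih hi
      exact ⟨c, by simp [hc], h⟩

theorem isCluster_node_iff {N A : Vertex → ℕ} {u : Vertex} {a : ℕ} {cs : List CarTree} :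
    IsCluster N A u (.node a cs) ↔ A u = a ∧
      List.Forall₂ (fun i c => IsCluster N A (i :: u) c) (occupiedChildren N A u) cs := by
  rw [IsCluster, ← Filter.map_add_atTop_eq_nat 1, Filter.eventually_map]
  simp only [cutCluster, CarTree.node.injEq, Filter.eventually_and, Filter.eventually_const]
  rw [eventually_map_eq_iff]
  rfl

theorem cutVisits_eq_zero {N A : Vertex → ℕ} {u : Vertex} (h : ¬ IsOccupied N A u) (m : ℕ) :
    cutVisits N A m u = 0 := by
  by_contra h0
  exact h ⟨m, Nat.one_le_iff_ne_zero.2 h0⟩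

open Classical in
-- Unoccupied children send no car, so parking in the cluster alone gives the same number of visits
-- as parking in the whole subtree.
theorem IsCluster.eventually_cutVisits {N A : Vertex → ℕ} {u : Vertex} {t : CarTree}
    (h : IsCluster N A u t) : ∀ᶠ m in Filter.atTop, cutVisits N A m u = t.rootVisits := by
  induction t using CarTree.induction generalizing u with
  | node a cs ih =>
    obtain ⟨hA, hcs⟩ := isCluster_node_iff.1 h
    have key : ∀ (l : List ℕ) (cs' : List CarTree), (∀ c ∈ cs', c ∈ cs) →
        List.Forall₂ (fun i c => IsCluster N A (i :: u) c) l cs' →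
        ∀ᶠ m in Filter.atTop, (l.map fun i => cutVisits N A m (i :: u) - 1).sum =
          (cs'.map fun c => c.rootVisits - 1).sum := by
      intro l cs' hcs hl
      induction hl with
      | nil => simp
      | cons hic _ ihl =>
        filter_upwards [ih _ (hcs _ (by simp)) hic, ihl fun c hc => hcs c (by simp [hc])]
          with m h1 h2
        simp [h1, h2]
    rw [← Filter.map_add_atTop_eq_nat 1, Filter.eventually_map]
    filter_upwards [key _ cs (fun c hc => hc) hcs] with m hm
    rw [cutVisits, CarTree.rootVisits, ← hm, hA]
    congr 1
    have : ∀ l : List ℕ, (l.map fun i => cutVisits N A m (i :: u) - 1).sum =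
        ((l.filter fun i => IsOccupied N A (i :: u)).map
          fun i => cutVisits N A m (i :: u) - 1).sum := by
      intro l
      induction l with
      | nil => rfl
      | cons i l ihl =>
        by_cases hi : IsOccupied N A (i :: u)
        · simp [hi, ihl]
        · simp [hi, ihl, cutVisits_eq_zero hi]
    exact this _

theorem IsCluster.isOccupied_iff {N A : Vertex → ℕ} {u : Vertex} {t : CarTree}
    (h : IsCluster N A u t) : IsOccupied N A u ↔ 1 ≤ t.rootVisits := by
  obtain ⟨m, hm⟩ := Filter.eventually_atTop.1 h.eventually_cutVisits
  constructor
  · rintro ⟨j, hj⟩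
    rw [← hm (max m j) (le_max_left _ _)]
    exact hj.trans (cutVisits_mono N A u (le_max_right m j))
  · intro h1
    exact ⟨m, by rw [hm m le_rfl]; exact h1⟩

theorem IsCluster.isFull {N A : Vertex → ℕ} {u : Vertex} {t : CarTree}
    (h : IsCluster N A u t) (hu : IsOccupied N A u) : t.IsFull := by
  induction t using CarTree.induction generalizing u with
  | node a cs ih =>
    refine CarTree.isFull_node.2 ⟨h.isOccupied_iff.1 hu, fun c hc => ?_⟩
    obtain ⟨_, h⟩ := isCluster_node_iff.1 h
    obtain ⟨i, hi, hic⟩ := exists_of_forall₂_of_mem_left h.flip hc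
    exact ih c hc hic (by simpa using List.of_mem_filter hi)

theorem IsVertex.of_suffix {N : Vertex → ℕ} {u v : Vertex} (h : u <:+ v) (hv : IsVertex N v) :
    IsVertex N u := by
  induction v with
  | nil => rw [List.suffix_nil.1 h]; exact hv
  | cons i v ih =>
    rcases List.suffix_cons_iff.1 h with rfl | h
    · exact hv
    · exact ih h hv.2

theorem mem_rootClusterSet {N A : Vertex → ℕ} {u : Vertex} :
    u ∈ rootClusterSet N A ↔ IsVertex N u ∧ ∀ v, v <:+ u → IsOccupied N A v :=
  and_congr_right fun hu => forall₂_congr fun _ hv => one_le_visits_iff N A (hu.of_suffix hv)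

theorem mem_rootClusterSet_of_suffix {N A : Vertex → ℕ} {u v : Vertex} (h : u <:+ v)
    (hv : v ∈ rootClusterSet N A) : u ∈ rootClusterSet N A :=
  ⟨hv.1.of_suffix h, fun w hw => hv.2 w (hw.trans h)⟩

theorem cons_mem_rootClusterSet {N A : Vertex → ℕ} {i : ℕ} {u : Vertex} :
    i :: u ∈ rootClusterSet N A ↔ i ∈ occupiedChildren N A u ∧ u ∈ rootClusterSet N A := by
  simp only [mem_rootClusterSet, IsVertex, occupiedChildren, List.mem_filter, List.mem_range,
    decide_eq_true_eq, List.suffix_cons_iff]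
  constructor
  · rintro ⟨⟨h1, h2⟩, h3⟩
    exact ⟨⟨h1, h3 _ (Or.inl rfl)⟩, h2, fun v hv => h3 v (Or.inr hv)⟩
  · rintro ⟨⟨h1, h2⟩, h3, h4⟩
    refine ⟨⟨h1, h3⟩, ?_⟩
    rintro v (rfl | hv)
    · exact h2
    · exact h4 v hv

theorem cutCluster_succ_eq {N A : Vertex → ℕ} {h : ℕ} {u : Vertex} (hu : u ∈ rootClusterSet N A)
    (hlen : ∀ w ∈ rootClusterSet N A, u <:+ w → w.length ≤ u.length + h) :
    cutCluster N A (h + 1) u = cutCluster N A h u := by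
  induction h generalizing u with
  | zero =>
    rw [cutCluster, cutCluster]
    have : occupiedChildren N A u = [] := by
      rw [List.eq_nil_iff_forall_not_mem]
      intro i hi
      have := hlen _ (cons_mem_rootClusterSet.2 ⟨hi, hu⟩) (List.suffix_cons i u)
      simp at this
    simp [this]
  | succ h ih =>
    rw [cutCluster, cutCluster]
    congr 1
    refine List.map_congr_left fun i hi => ih (cons_mem_rootClusterSet.2 ⟨hi, hu⟩) ?_
    intro w hw hs
    have := hlen w hw ((List.suffix_cons i u).trans hs)
    simp; omega

theorem IsCluster.finite {N A : Vertex → ℕ} {u : Vertex} {t : CarTree} (h : IsCluster N A u t) :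
    {w ∈ rootClusterSet N A | u <:+ w}.Finite := by
  induction t using CarTree.induction generalizing u with
  | node a cs ih =>
    obtain ⟨_, h⟩ := isCluster_node_iff.1 h
    have hsub : {w ∈ rootClusterSet N A | u <:+ w} ⊆
        {u} ∪ ⋃ i ∈ {i | i ∈ occupiedChildren N A u},
          {w ∈ rootClusterSet N A | i :: u <:+ w} := by
      rintro w ⟨hw, v, rfl⟩
      rcases List.eq_nil_or_concat v with rfl | ⟨v, i, rfl⟩
      · simp
      · right
        have hs : i :: u <:+ v.concat i ++ u := ⟨v, by simp⟩
        simp only [Set.mem_iUnion]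
        exact ⟨i, (cons_mem_rootClusterSet.1 (mem_rootClusterSet_of_suffix hs hw)).1, hw, hs⟩
    refine Set.Finite.subset ?_ hsub
    refine (Set.finite_singleton u).union (Set.Finite.biUnion (List.finite_toSet _) ?_)
    intro i hi
    obtain ⟨c, hc, hic⟩ := exists_of_forall₂_of_mem_left h hi
    exact ih c hc hic

/-- The suffixes of `w`, that is `w` and its ancestors, are `w.length + 1` distinct elements of the
cluster. -/
theorem length_lt_ncard {N A : Vertex → ℕ} (hfin : (rootClusterSet N A).Finite) {w : Vertex}
    (hw : w ∈ rootClusterSet N A) : w.length < (rootClusterSet N A).ncard := by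
  have h1 : (fun i => w.drop i) '' (Finset.range (w.length + 1) : Set ℕ) ⊆
      rootClusterSet N A := by
    rintro _ ⟨i, _, rfl⟩
    exact mem_rootClusterSet_of_suffix (List.drop_suffix i w) hw
  have h2 := Set.ncard_le_ncard h1 hfin
  rw [Set.InjOn.ncard_image, Set.ncard_coe_finset, Finset.card_range] at h2
  · exact h2
  · intro i hi j hj hij
    have := congrArg List.length hij
    simp at this hi hj
    omega

/-- The cluster is lower than its cardinality, so every deeper truncation agrees with the one used
in the definition; conversely a limiting finite tree forces the set to be finite. -/
theorem rootCluster_eq_some_iff {N A : Vertex → ℕ} {t : CarTree} :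
    rootCluster N A = some t ↔ IsOccupied N A [] ∧ IsCluster N A [] t := by
  have hroot : IsOccupied N A [] ↔ [] ∈ rootClusterSet N A := by
    rw [mem_rootClusterSet]
    simp [IsVertex, List.suffix_nil]
  have key : ∀ t, rootCluster N A = some t → IsOccupied N A [] ∧ IsCluster N A [] t := by
    intro t ht
    rw [rootCluster] at ht
    split_ifs at ht with h
    obtain ⟨⟨w, hw⟩, hfin⟩ := h
    have h0 := mem_rootClusterSet_of_suffix (List.nil_suffix (l := w)) hw
    refine ⟨hroot.2 h0, ?_⟩
    rw [Option.some.injEq, clusterUpTo_eq_cutCluster _ _ _ (u := []) trivial] at ht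
    refine Filter.eventually_atTop.2 ⟨(rootClusterSet N A).ncard, fun h hh => ?_⟩
    · induction h, hh using Nat.le_induction with
      | base => exact ht
      | succ h hh ih =>
        rw [cutCluster_succ_eq h0, ih]
        intro w hw _
        have := length_lt_ncard hfin hw
        simp; omega
  refine ⟨key t, fun ⟨h1, h2⟩ => ?_⟩
  have hfin : (rootClusterSet N A).Finite := h2.finite.subset fun w hw => ⟨hw, List.nil_suffix⟩
  have h3 : rootCluster N A = some (clusterUpTo N A (rootClusterSet N A).ncard []) :=
    if_pos ⟨⟨[], hroot.1 h1⟩, hfin⟩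
  rw [h3, (key _ h3).2.unique h2]

/-! ### Occupied paths and finiteness of the cluster -/

/-- When the tree is cut `m` generations below `u`, there is a path of length `j` of occupied
vertices going down from `u`. -/
def HasPath (N A : Vertex → ℕ) : ℕ → ℕ → Vertex → Prop
  | m, 0, u => 1 ≤ cutVisits N A m u
  | 0, _ + 1, _ => False
  | m + 1, j + 1, u => 1 ≤ cutVisits N A (m + 1) u ∧ ∃ i < N u, HasPath N A m j (i :: u)

theorem HasPath.le {N A : Vertex → ℕ} {m j : ℕ} {u : Vertex} (h : HasPath N A m j u) : j ≤ m := by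
  induction j generalizing m u with
  | zero => exact Nat.zero_le _
  | succ j ih =>
    cases m with
    | zero => exact h.elim
    | succ m => obtain ⟨_, i, _, h⟩ := h; exact Nat.succ_le_succ (ih h)

theorem HasPath.one_le {N A : Vertex → ℕ} {m j : ℕ} {u : Vertex} (h : HasPath N A m j u) :
    1 ≤ cutVisits N A m u := by
  cases j with
  | zero => simpa only [HasPath] using h
  | succ j =>
    cases m with
    | zero => exact h.elim
    | succ m => exact h.1

theorem HasPath.succ {N A : Vertex → ℕ} {m j : ℕ} {u : Vertex} (h : HasPath N A m j u) :
    HasPath N A (m + 1) j u := by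
  induction j generalizing m u with
  | zero =>
    simp only [HasPath] at h ⊢
    exact h.trans (cutVisits_le_succ N A m u)
  | succ j ih =>
    cases m with
    | zero => exact h.elim
    | succ m =>
      obtain ⟨h, i, hi, hp⟩ := h
      exact ⟨h.trans (cutVisits_le_succ N A _ u), i, hi, ih hp⟩

theorem HasPath.mono {N A : Vertex → ℕ} {m n j : ℕ} {u : Vertex} (h : HasPath N A m j u)
    (hmn : m ≤ n) : HasPath N A n j u := by
  induction n, hmn using Nat.le_induction with
  | base => exact h
  | succ n _ ih => exact ih.succ

/-- A car from the last generation can influence `u` only along a path that is occupied all the way.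
If `u` is occupied, no child has such a path, and induction applies to each child; if not,
monotonicity in the cut settles the matter. -/
theorem stable_of_not_hasPath {N A : Vertex → ℕ} {m : ℕ} {u : Vertex}
    (h : ¬ HasPath N A (m + 1) (m + 1) u) :
    cutVisits N A (m + 1) u = cutVisits N A m u ∧
      ∀ j, HasPath N A (m + 1) j u → HasPath N A m j u := by
  induction m generalizing u with
  | zero =>
    rw [zero_add] at h ⊢
    by_cases h0 : cutVisits N A 1 u = 0
    · refine ⟨h0.trans (Nat.le_zero.1 ((cutVisits_le_succ N A 0 u).trans h0.le)).symm, fun j hj => ?_⟩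
      exact absurd hj.one_le (by rw [h0]; decide)
    · have hc : ∀ i < N u, cutVisits N A 0 (i :: u) = 0 := by
        intro i hi
        by_contra h1
        refine h ⟨Nat.one_le_iff_ne_zero.2 h0, i, hi, ?_⟩
        simp only [HasPath]; omega
      have hT : cutVisits N A 1 u = cutVisits N A 0 u := by
        have : ∑ i ∈ Finset.range (N u), (cutVisits N A 0 (i :: u) - 1) = 0 :=
          Finset.sum_eq_zero fun i hi => by simp [hc i (Finset.mem_range.1 hi)]
        change A u + _ = A u
        rw [this, add_zero]
      refine ⟨hT, fun j hj => ?_⟩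
      cases j with
      | zero => simpa only [HasPath, hT] using hj
      | succ j =>
        obtain ⟨_, i, hi, hj⟩ := hj
        have := hj.one_le
        rw [hc i hi] at this
        omega
  | succ m ih =>
    by_cases h0 : cutVisits N A (m + 2) u = 0
    · refine ⟨h0.trans (Nat.le_zero.1 ((cutVisits_le_succ N A (m + 1) u).trans h0.le)).symm,
        fun j hj => ?_⟩
      exact absurd hj.one_le (by rw [h0]; decide)
    · have hc : ∀ i < N u, ¬ HasPath N A (m + 1) (m + 1) (i :: u) := fun i hi hp =>
        h ⟨Nat.one_le_iff_ne_zero.2 h0, i, hi, hp⟩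
      have hT : cutVisits N A (m + 2) u = cutVisits N A (m + 1) u := by
        rw [cutVisits, cutVisits]
        congr 1
        exact Finset.sum_congr rfl fun i hi => by rw [(ih (hc i (Finset.mem_range.1 hi))).1]
      refine ⟨hT, fun j hj => ?_⟩
      cases j with
      | zero => simpa only [HasPath, hT] using hj
      | succ j =>
        obtain ⟨_, i, hi, hj⟩ := hj
        exact ⟨hT ▸ Nat.one_le_iff_ne_zero.2 h0, i, hi, (ih (hc i hi)).2 j hj⟩

theorem exists_hasPath {N A : Vertex → ℕ} {w u : Vertex} (hv : IsVertex N (w ++ u))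
    (ho : ∀ v, v <:+ w → IsOccupied N A (v ++ u)) : ∃ m, HasPath N A m w.length u := by
  -- Words end at the root, so removing the last letter of `w` moves the base point from `u` to its
  -- child `i :: u`.
  induction w using List.reverseRecOn generalizing u with
  | nil =>
    obtain ⟨m, hm⟩ := ho [] List.nil_suffix
    exact ⟨m, by simpa only [HasPath, List.length_nil, List.nil_append] using hm⟩
  | append_singleton w i ih =>
    rw [List.append_assoc, List.singleton_append] at hv
    obtain ⟨m, hm⟩ := ih hv fun v hvw => by
      have := ho (v ++ [i]) (by rwa [List.suffix_append_inj_of_length_eq rfl |>.trans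
        (and_iff_left rfl)])
      simpa using this
    obtain ⟨n, hn⟩ := ho [] List.nil_suffix
    refine ⟨max m n + 1, ?_⟩
    rw [List.length_append, List.length_singleton]
    refine ⟨hn.trans (cutVisits_mono N A u ?_), i, ?_, hm.mono (le_max_left _ _)⟩
    · have := le_max_right m n; omega
    · exact (hv.of_suffix (List.suffix_append w (i :: u))).1

theorem finite_rootClusterSet {N A : Vertex → ℕ}
    (h : ∀ᶠ m in Filter.atTop, ¬ HasPath N A m m []) : (rootClusterSet N A).Finite := by
  obtain ⟨M, hM⟩ := Filter.eventually_atTop.1 h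
  have hstable : ∀ n ≥ M, ∀ j, HasPath N A n j [] → HasPath N A M j [] := by
    intro n hn
    induction n, hn using Nat.le_induction with
    | base => exact fun j hj => hj
    | succ n hn ih => exact fun j hj => ih j ((stable_of_not_hasPath (hM _ (by omega))).2 j hj)
  have hsub : rootClusterSet N A ⊆ ⋃ m ∈ Finset.range (M + 1), {w | w ∈ layer N m} := by
    intro w hw
    have hw' := mem_rootClusterSet.1 hw
    obtain ⟨m, hm⟩ := exists_hasPath (N := N) (A := A) (w := w) (u := [])
      (by simpa using hw'.1) (by simpa using hw'.2)
    have := (hstable _ (le_max_left M m) _ (hm.mono (le_max_right M m))).le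
    simp only [Set.mem_iUnion]
    exact ⟨w.length, by simp; omega, mem_layer.2 ⟨hw'.1, rfl⟩⟩
  refine Set.Finite.subset ?_ hsub
  exact Set.Finite.biUnion (Finset.finite_toSet _) fun m _ => List.finite_toSet _

theorem exists_rootCluster_eq_some {N A : Vertex → ℕ} (h0 : IsOccupied N A [])
    (h : ∀ᶠ m in Filter.atTop, ¬ HasPath N A m m []) : ∃ t, rootCluster N A = some t := by
  refine ⟨_, if_pos ⟨⟨[], mem_rootClusterSet.2 ⟨trivial, fun v hv => ?_⟩⟩,
    finite_rootClusterSet h⟩⟩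
  rw [List.suffix_nil.1 hv]; exact h0

/-! ### Extra flux brought by one more generation -/

/-- Sum of the weights `φ v` over the vertices `v` at distance `m` below `u` which are linked to
`u` by a path of occupied vertices, when the tree is cut `m` generations below `u`. -/
def linkedSum (N A φ : Vertex → ℕ) : ℕ → Vertex → ℕ
  | 0, u => if 1 ≤ A u then φ u else 0
  | m + 1, u => if 1 ≤ cutVisits N A (m + 1) u then
      ∑ i ∈ Finset.range (N u), linkedSum N A φ m (i :: u) else 0

theorem linkedSum_eq_zero_of_not_occupied {N A φ : Vertex → ℕ} {m : ℕ} {u : Vertex}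
    (h : cutVisits N A m u = 0) : linkedSum N A φ m u = 0 := by
  cases m with
  | zero => simp only [cutVisits] at h; simp [linkedSum, h]
  | succ m => simp [linkedSum, h]

theorem not_hasPath_of_linkedSum_eq_zero {N A : Vertex → ℕ} {m : ℕ} {u : Vertex}
    (h : linkedSum N A (fun _ => 1) m u = 0) : ¬ HasPath N A m m u := by
  induction m generalizing u with
  | zero => simpa [linkedSum, HasPath, cutVisits] using h
  | succ m ih =>
    rintro ⟨h1, i, hi, hp⟩
    rw [linkedSum, if_pos h1, Finset.sum_eq_zero_iff] at h
    exact ih (h i (Finset.mem_range.2 hi)) hp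

/-- The first child of `u` exists, and at least two cars arrive on it. -/
def FirstChildOverflows (N A : Vertex → ℕ) (u : Vertex) : Prop := 1 ≤ N u ∧ 2 ≤ A (0 :: u)

instance (N A : Vertex → ℕ) (u : Vertex) : Decidable (FirstChildOverflows N A u) :=
  inferInstanceAs (Decidable (_ ∧ _))

/-- Each linked vertex whose first child overflows receives an extra car, and this car cannot park
before `u` because all the spots on its way are already taken. -/
theorem cutVisits_add_linkedSum_le (N A : Vertex → ℕ) (m : ℕ) (u : Vertex) :
    cutVisits N A m u + linkedSum N A (fun v => if FirstChildOverflows N A v then 1 else 0) m u ≤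
      cutVisits N A (m + 1) u := by
  induction m generalizing u with
  | zero =>
    rw [linkedSum]
    split_ifs with h1 h2
    · have : cutVisits N A 0 (0 :: u) - 1 ≤
          ∑ i ∈ Finset.range (N u), (cutVisits N A 0 (i :: u) - 1) :=
        Finset.single_le_sum (f := fun i => cutVisits N A 0 (i :: u) - 1) (fun _ _ => Nat.zero_le _)
          (Finset.mem_range.2 h2.1)
      have h3 := h2.2
      rw [cutVisits, cutVisits]
      simp only [cutVisits] at this ⊢
      omega
    · exact cutVisits_le_succ N A 0 u
    · exact cutVisits_le_succ N A 0 u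
  | succ m ih =>
    have h1 : ∀ i, (cutVisits N A m (i :: u) - 1) +
        linkedSum N A (fun v => if FirstChildOverflows N A v then 1 else 0) m (i :: u) ≤
          cutVisits N A (m + 1) (i :: u) - 1 := by
      intro i
      have := ih (i :: u)
      -- The truncated subtraction loses nothing: either the child is occupied, or it carries no
      -- linked vertex.
      rcases Nat.eq_zero_or_pos (cutVisits N A m (i :: u)) with h | h
      · rw [linkedSum_eq_zero_of_not_occupied h, h]; simp
      · omega
    have h2 : linkedSum N A (fun v => if FirstChildOverflows N A v then 1 else 0) (m + 1) u ≤
        ∑ i ∈ Finset.range (N u),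
          linkedSum N A (fun v => if FirstChildOverflows N A v then 1 else 0) m (i :: u) := by
      rw [linkedSum]; split_ifs <;> simp
    calc _ ≤ A u + ∑ i ∈ Finset.range (N u), (cutVisits N A m (i :: u) - 1) + _ :=
          Nat.add_le_add_left h2 _
      _ = A u + ∑ i ∈ Finset.range (N u), ((cutVisits N A m (i :: u) - 1) +
        linkedSum N A (fun v => if FirstChildOverflows N A v then 1 else 0) m (i :: u)) := by
          rw [Finset.sum_add_distrib, add_assoc]
      _ ≤ _ := by
          exact Nat.add_le_add_left (Finset.sum_le_sum fun i _ => h1 i) (A u)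

/-! ### Measurability and conditional means -/

section Measurability

variable {Ω : Type*} {mΩ : MeasurableSpace Ω}

theorem measurable_sum_range {n : Ω → ℕ} {f : ℕ → Ω → ℕ} (hn : Measurable n)
    (hf : ∀ i, Measurable (f i)) : Measurable fun ω => ∑ i ∈ Finset.range (n ω), f i ω := by
  have h : Measurable fun p : ℕ × Ω => ∑ i ∈ Finset.range p.1, f i p.2 :=
    measurable_from_prod_countable_right fun n =>
      Finset.measurable_fun_sum (Finset.range n) fun i _ => hf i
  exact h.comp (hn.prodMk measurable_id)

theorem measurable_cutVisits {N A : Vertex → Ω → ℕ} {m : ℕ} {u : Vertex}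
    (hN : ∀ w, u <:+ w → w.length < u.length + m → Measurable (N w))
    (hA : ∀ w, u <:+ w → w.length ≤ u.length + m → Measurable (A w)) :
    Measurable fun ω => cutVisits (fun w => N w ω) (fun w => A w ω) m u := by
  induction m generalizing u with
  | zero => exact hA u List.suffix_rfl le_rfl
  | succ m ih =>
    refine (hA u List.suffix_rfl (by omega)).add (measurable_sum_range
      (hN u List.suffix_rfl (by omega)) fun i => ?_)
    refine (measurable_from_top (f := fun n : ℕ => n - 1)).comp (ih ?_ ?_)
    · exact fun w hw hl => hN w ((List.suffix_cons i u).trans hw) (by simp at hl; omega)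
    · exact fun w hw hl => hA w ((List.suffix_cons i u).trans hw) (by simp at hl; omega)

theorem measurable_linkedSum {N A φ : Vertex → Ω → ℕ} {m : ℕ} {u : Vertex}
    (hN : ∀ w, u <:+ w → w.length < u.length + m → Measurable (N w))
    (hA : ∀ w, u <:+ w → w.length ≤ u.length + m → Measurable (A w))
    (hφ : ∀ w, Measurable (φ w)) :
    Measurable fun ω =>
      linkedSum (fun w => N w ω) (fun w => A w ω) (fun w => φ w ω) m u := by
  induction m generalizing u with
  | zero =>
    exact Measurable.ite (measurableSet_le measurable_const (hA u List.suffix_rfl le_rfl)) (hφ u)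
      measurable_const
  | succ m ih =>
    refine Measurable.ite (measurableSet_le measurable_const (measurable_cutVisits hN hA))
      (measurable_sum_range (hN u List.suffix_rfl (by omega)) fun i => ih ?_ ?_) measurable_const
    · exact fun w hw hl => hN w ((List.suffix_cons i u).trans hw) (by simp at hl; omega)
    · exact fun w hw hl => hA w ((List.suffix_cons i u).trans hw) (by simp at hl; omega)

theorem measurableSet_isOccupied {N A : Vertex → Ω → ℕ} {u : Vertex}
    (hN : ∀ w, u <:+ w → Measurable (N w)) (hA : ∀ w, u <:+ w → Measurable (A w)) :
    MeasurableSet {ω | IsOccupied (fun w => N w ω) (fun w => A w ω) u} := by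
  have : {ω | IsOccupied (fun w => N w ω) (fun w => A w ω) u} =
      ⋃ m, {ω | 1 ≤ cutVisits (fun w => N w ω) (fun w => A w ω) m u} := by
    ext ω; simp [IsOccupied]
  rw [this]
  exact MeasurableSet.iUnion fun m => measurableSet_le measurable_const
    (measurable_cutVisits (fun w hw _ => hN w hw) fun w hw _ => hA w hw)

theorem natCast_sum_range_eq_tsum (n : ℕ) (f : ℕ → ℕ) :
    ((∑ i ∈ Finset.range n, f i : ℕ) : ℝ≥0∞) = ∑' i, if i < n then (f i : ℝ≥0∞) else 0 := by
  rw [tsum_eq_sum (s := Finset.range n)]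
  · push_cast
    exact Finset.sum_congr rfl fun i hi => by rw [if_pos (Finset.mem_range.1 hi)]
  · intro i hi
    rw [if_neg (by simpa using hi)]

end Measurability

/-- If the weight of each vertex of height `h` has conditional mean `c` given the tree cut above
height `h`, then the mean of the weighted sum is `c` times the mean of the sum. -/
theorem setLIntegral_linkedSum {Ω : Type*} {m0 mΩ : MeasurableSpace Ω} {P : Measure Ω}
    {N A φ : Vertex → Ω → ℕ} {h : ℕ} {c : ℝ≥0∞}
    (hm0 : m0 ≤ mΩ)
    (hN : ∀ w, Measurable (N w)) (hA : ∀ w, Measurable (A w))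
    (hN0 : ∀ w, w.length < h → Measurable[m0] (N w))
    (hA0 : ∀ w, w.length ≤ h → Measurable[m0] (A w)) (hφ : ∀ w, Measurable (φ w))
    (hc : ∀ w, w.length = h → ∀ s, MeasurableSet[m0] s → ∫⁻ ω in s, φ w ω ∂P = c * P s)
    (m : ℕ) (u : Vertex) (hu : u.length + m = h) (s : Set Ω) (hs : MeasurableSet[m0] s) :
    ∫⁻ ω in s, linkedSum (fun w => N w ω) (fun w => A w ω) (fun w => φ w ω) m u ∂P =
      c * ∫⁻ ω in s, linkedSum (fun w => N w ω) (fun w => A w ω) (fun _ => 1) m u ∂P := by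
  induction m generalizing u s with
  | zero =>
    have hE : MeasurableSet[m0] {ω | 1 ≤ A u ω} :=
      measurableSet_le measurable_const (hA0 u (by omega))
    have key : ∀ ψ : Ω → ℕ, ∫⁻ ω in s, ((if 1 ≤ A u ω then ψ ω else 0 : ℕ) : ℝ≥0∞) ∂P =
        ∫⁻ ω in s ∩ {ω | 1 ≤ A u ω}, ψ ω ∂P := by
      intro ψ
      rw [Set.inter_comm, ← setLIntegral_indicator (hm0 _ hE)]
      refine lintegral_congr fun ω => ?_
      by_cases h1 : 1 ≤ A u ω
      · simp [Set.indicator, h1]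
      · simp [Set.indicator, h1]
    simp only [linkedSum]
    rw [key, key, hc u (by omega) _ (hs.inter hE)]
    simp
  | succ m ih =>
    -- The condition for descending to child `i` is known from the cut tree, so it can be absorbed
    -- into the set `s`; this is why the statement ranges over all such sets.
    have hE : ∀ i, MeasurableSet[m0] {ω | i < N u ω ∧
        1 ≤ cutVisits (fun w => N w ω) (fun w => A w ω) (m + 1) u} := by
      intro i
      refine MeasurableSet.inter (measurableSet_lt measurable_const (hN0 u (by omega)))
        (measurableSet_le measurable_const (measurable_cutVisits ?_ ?_))
      · exact fun w _ hl => hN0 w (by omega)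
      · exact fun w _ hl => hA0 w (by omega)
    have key : ∀ ψ : Vertex → Ω → ℕ, (∀ w, Measurable (ψ w)) →
        ∫⁻ ω in s, linkedSum (fun w => N w ω) (fun w => A w ω) (fun w => ψ w ω) (m + 1) u ∂P =
        ∑' i, ∫⁻ ω in s ∩ {ω | i < N u ω ∧
          1 ≤ cutVisits (fun w => N w ω) (fun w => A w ω) (m + 1) u},
          linkedSum (fun w => N w ω) (fun w => A w ω) (fun w => ψ w ω) m (i :: u) ∂P := by
      intro ψ hψ
      have hmeas : ∀ i, Measurable fun ω => ((linkedSum (fun w => N w ω) (fun w => A w ω)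
          (fun w => ψ w ω) m (i :: u) : ℕ) : ℝ≥0∞) := fun i =>
        measurable_from_top.comp (measurable_linkedSum (fun w _ _ => hN w) (fun w _ _ => hA w) hψ)
      rw [tsum_congr fun i => by
        rw [Set.inter_comm, ← setLIntegral_indicator (hm0 _ (hE i))]]
      rw [← lintegral_tsum fun i => ((hmeas i).indicator (hm0 _ (hE i))).aemeasurable]
      refine lintegral_congr fun ω => ?_
      by_cases h1 : 1 ≤ cutVisits (fun w => N w ω) (fun w => A w ω) (m + 1) u
      · rw [linkedSum, if_pos h1, natCast_sum_range_eq_tsum]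
        refine tsum_congr fun i => ?_
        simp [Set.indicator, h1]
      · rw [linkedSum, if_neg h1]
        simp [Set.indicator, h1]
    rw [key φ hφ, key (fun _ _ => 1) fun _ => measurable_const, ← ENNReal.tsum_mul_left]
    refine tsum_congr fun i => ih (i :: u) (by simp; omega) _ (hs.inter (hE i))

/-! ### The random model and the consequences of subcriticality -/

/-- Under `P`, the offspring numbers `N` are geometric of parameter `q`, the car arrivals `A` have
law `μ`, and all these variables are independent. -/
structure IsModel {Ω : Type*} [MeasurableSpace Ω] (P : Measure Ω) (q : ℝ) (μ : PMF ℕ)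
    (N A : Vertex → Ω → ℕ) : Prop where
  pos : 0 < q
  lt_one : q < 1
  measurable_offspring : ∀ u, Measurable (N u)
  measurable_arrivals : ∀ u, Measurable (A u)
  indep : iIndepFun (Sum.elim N A) P
  offspring_law : ∀ u j, P {ω | N u ω = j} = ENNReal.ofReal (q ^ j * (1 - q))
  arrivals_law : ∀ u j, P {ω | A u ω = j} = μ j

/-- The σ-algebra generated by the offspring numbers and the car arrivals indexed by `I`. -/
@[reducible]
def sigmaOf {Ω : Type*} (N A : Vertex → Ω → ℕ) (I : Set (Vertex ⊕ Vertex)) : MeasurableSpace Ω :=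
  ⨆ s ∈ I, MeasurableSpace.comap (Sum.elim N A s) inferInstance

theorem measurable_sigmaOf_inl {Ω : Type*} {N A : Vertex → Ω → ℕ} {I : Set (Vertex ⊕ Vertex)}
    {u : Vertex} (h : Sum.inl u ∈ I) : Measurable[sigmaOf N A I] (N u) :=
  Measurable.mono (comap_measurable (Sum.elim N A (Sum.inl u)))
    (le_iSup₂ (f := fun s (_ : s ∈ I) => MeasurableSpace.comap (Sum.elim N A s) inferInstance)
      (Sum.inl u) h) le_rfl

theorem measurable_sigmaOf_inr {Ω : Type*} {N A : Vertex → Ω → ℕ} {I : Set (Vertex ⊕ Vertex)}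
    {u : Vertex} (h : Sum.inr u ∈ I) : Measurable[sigmaOf N A I] (A u) :=
  Measurable.mono (comap_measurable (Sum.elim N A (Sum.inr u)))
    (le_iSup₂ (f := fun s (_ : s ∈ I) => MeasurableSpace.comap (Sum.elim N A s) inferInstance)
      (Sum.inr u) h) le_rfl

/-- Indices of the variables attached to the descendants of `u`. -/
def below (u : Vertex) : Set (Vertex ⊕ Vertex) :=
  {s | Sum.elim (fun w => u <:+ w) (fun w => u <:+ w) s}

/-- Indices of the variables determining the tree cut above height `h`. -/
def upTo (h : ℕ) : Set (Vertex ⊕ Vertex) :=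
  {s | Sum.elim (fun w => w.length < h) (fun w => w.length ≤ h) s}

section Model

variable {Ω : Type*} {mΩ : MeasurableSpace Ω} {P : Measure Ω} {q : ℝ} {μ : PMF ℕ}
  {N A : Vertex → Ω → ℕ}

theorem IsModel.sigmaOf_le (h : IsModel P q μ N A) (I : Set (Vertex ⊕ Vertex)) :
    sigmaOf N A I ≤ mΩ := by
  refine iSup₂_le fun s _ => ?_
  rw [← measurable_iff_comap_le]
  cases s
  · exact h.measurable_offspring _
  · exact h.measurable_arrivals _

theorem IsModel.indep_sigmaOf (h : IsModel P q μ N A) {I J : Set (Vertex ⊕ Vertex)}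
    (hIJ : Disjoint I J) : Indep (sigmaOf N A I) (sigmaOf N A J) P := by
  refine indep_iSup_of_disjoint (fun s => ?_) ((iIndepFun_iff_iIndep _ _ _).1 h.indep) hIJ
  rw [← measurable_iff_comap_le]
  cases s
  · exact h.measurable_offspring _
  · exact h.measurable_arrivals _

theorem IsModel.measure_inter (h : IsModel P q μ N A) {I J : Set (Vertex ⊕ Vertex)}
    (hIJ : Disjoint I J) {s t : Set Ω} (hs : MeasurableSet[sigmaOf N A I] s)
    (ht : MeasurableSet[sigmaOf N A J] t) : P (s ∩ t) = P s * P t :=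
  (Indep_iff _ _ _).1 (h.indep_sigmaOf hIJ) s t hs ht

theorem IsModel.measure_le_offspring [IsProbabilityMeasure P] (h : IsModel P q μ N A)
    (u : Vertex) (i : ℕ) :
    P {ω | i ≤ N u ω} = ENNReal.ofReal (q ^ i) := by
  have hq := h.pos
  have hq1 := h.lt_one
  induction i with
  | zero => simp
  | succ i ih =>
    have h1 : {ω | i ≤ N u ω} = {ω | N u ω = i} ∪ {ω | i + 1 ≤ N u ω} := by
      ext ω; simp; omega
    have h2 : Disjoint {ω | N u ω = i} {ω | i + 1 ≤ N u ω} := by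
      rw [Set.disjoint_left]; intro ω h1 h2; simp at h1 h2; omega
    rw [h1, measure_union h2 (measurableSet_le measurable_const (h.measurable_offspring u)),
      h.offspring_law] at ih
    have h3 : ENNReal.ofReal (q ^ i) =
        ENNReal.ofReal (q ^ i * (1 - q)) + ENNReal.ofReal (q ^ (i + 1)) := by
      rw [← ENNReal.ofReal_add (by have : 0 < 1 - q := by linarith
                                   positivity) (by positivity)]
      congr 1; ring
    rw [h3] at ih
    exact (ENNReal.add_right_inj ENNReal.ofReal_ne_top).1 ih

theorem IsModel.measure_arrivals_mem (h : IsModel P q μ N A) (u : Vertex) (s : Set ℕ) :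
    P {ω | A u ω ∈ s} = μ.toMeasure s := by
  have h1 : Measure.map (A u) P = μ.toMeasure := by
    refine Measure.ext_of_singleton fun j => ?_
    rw [Measure.map_apply (h.measurable_arrivals u) (measurableSet_singleton j),
      PMF.toMeasure_apply_singleton _ _ (measurableSet_singleton j)]
    exact h.arrivals_law u j
  rw [← h1, Measure.map_apply (h.measurable_arrivals u) (MeasurableSet.of_discrete)]
  rfl

theorem IsModel.measurable_cutVisits (h : IsModel P q μ N A) (u : Vertex) (m : ℕ) :
    Measurable fun ω => cutVisits (fun w => N w ω) (fun w => A w ω) m u :=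
  Parking.measurable_cutVisits (fun w _ _ => h.measurable_offspring w) fun w _ _ => h.measurable_arrivals w

theorem IsModel.measure_firstChildOverflows [IsProbabilityMeasure P] (h : IsModel P q μ N A)
    (u : Vertex) : P {ω | FirstChildOverflows (fun w => N w ω) (fun w => A w ω) u} =
      ENNReal.ofReal q * μ.toMeasure {a | 2 ≤ a} := by
  have hA : MeasurableSet[sigmaOf N A {Sum.inr (0 :: u)}] {ω | A (0 :: u) ω ∈ {a | 2 ≤ a}} :=
    measurableSet_le measurable_const (measurable_sigmaOf_inr (by simp))
  have := h.measure_inter (I := {Sum.inl u}) (J := {Sum.inr (0 :: u)})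
    (s := {ω | 1 ≤ N u ω}) (t := {ω | A (0 :: u) ω ∈ {a | 2 ≤ a}}) (by simp)
    (measurableSet_le measurable_const (measurable_sigmaOf_inl (by simp))) hA
  rw [h.measure_le_offspring, h.measure_arrivals_mem, pow_one] at this
  exact this

theorem IsModel.setLIntegral_firstChildOverflows [IsProbabilityMeasure P]
    (h : IsModel P q μ N A) (u : Vertex) (s : Set Ω)
    (hs : MeasurableSet[sigmaOf N A (upTo u.length)] s) :
    ∫⁻ ω in s, (if FirstChildOverflows (fun w => N w ω) (fun w => A w ω) u then 1 else 0 : ℕ) ∂P =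
      ENNReal.ofReal q * μ.toMeasure {a | 2 ≤ a} * P s := by
  have hG : MeasurableSet[sigmaOf N A {Sum.inl u, Sum.inr (0 :: u)}]
      {ω | FirstChildOverflows (fun w => N w ω) (fun w => A w ω) u} :=
    MeasurableSet.inter (measurableSet_le measurable_const (measurable_sigmaOf_inl (by simp)))
      (measurableSet_le measurable_const (measurable_sigmaOf_inr (by simp)))
  -- The tree cut at the height of `u` involves the arrivals at that height but not the offspring
  -- numbers, so both `N u` and `A (0 :: u)` are independent of it.
  have hind := h.measure_inter (J := upTo u.length) (t := s) (by
    rw [Set.disjoint_left]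
    rintro s (rfl | rfl) <;> simp [upTo]) hG hs
  rw [h.measure_firstChildOverflows] at hind
  rw [← hind, ← Measure.restrict_apply (h.sigmaOf_le _ _ hG),
    ← lintegral_indicator_one (h.sigmaOf_le _ _ hG)]
  refine lintegral_congr fun ω => ?_
  by_cases h1 : FirstChildOverflows (fun w => N w ω) (fun w => A w ω) u
  · simp [Set.indicator, h1]
  · simp [Set.indicator, h1]

theorem IsModel.measurable_linkedSum (h : IsModel P q μ N A) (u : Vertex) (m : ℕ)
    {φ : Vertex → Ω → ℕ} (hφ : ∀ w, Measurable (φ w)) :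
    Measurable fun ω =>
      linkedSum (fun w => N w ω) (fun w => A w ω) (fun w => φ w ω) m u :=
  Parking.measurable_linkedSum (fun w _ _ => h.measurable_offspring w)
    (fun w _ _ => h.measurable_arrivals w) hφ

theorem IsModel.lintegral_cutVisits_succ [IsProbabilityMeasure P] (h : IsModel P q μ N A)
    (m : ℕ) :
    ∫⁻ ω, cutVisits (fun w => N w ω) (fun w => A w ω) m [] ∂P +
      ENNReal.ofReal q * μ.toMeasure {a | 2 ≤ a} *
        ∫⁻ ω, linkedSum (fun w => N w ω) (fun w => A w ω) (fun _ => 1) m [] ∂P ≤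
      ∫⁻ ω, cutVisits (fun w => N w ω) (fun w => A w ω) (m + 1) [] ∂P := by
  have hmφ : ∀ u, Measurable fun ω =>
      if FirstChildOverflows (fun w => N w ω) (fun w => A w ω) u then 1 else 0 := fun u =>
    Measurable.ite (MeasurableSet.inter (measurableSet_le measurable_const
      (h.measurable_offspring u)) (measurableSet_le measurable_const
      (h.measurable_arrivals (0 :: u)))) measurable_const measurable_const
  have key := setLIntegral_linkedSum (h.sigmaOf_le (upTo m)) h.measurable_offspring
    h.measurable_arrivals (h := m)
    (fun w hw => measurable_sigmaOf_inl (show w.length < m from hw))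
    (fun w hw => measurable_sigmaOf_inr (show w.length ≤ m from hw)) hmφ
    (fun w hw s hs => h.setLIntegral_firstChildOverflows w s (by rw [hw]; exact hs))
    m [] (by simp) Set.univ MeasurableSet.univ
  rw [setLIntegral_univ, setLIntegral_univ] at key
  have hT : Measurable fun ω =>
      (cutVisits (fun w => N w ω) (fun w => A w ω) m [] : ℝ≥0∞) :=
    measurable_from_top.comp (h.measurable_cutVisits [] m)
  rw [← key, ← lintegral_add_left hT]
  refine lintegral_mono fun ω => ?_
  rw [← Nat.cast_add, Nat.cast_le]
  exact cutVisits_add_linkedSum_le (fun w => N w ω) (fun w => A w ω) m []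

theorem cutVisits_le_X (m : ℕ) (ω : Ω) :
    (cutVisits (fun w => N w ω) (fun w => A w ω) m [] : ℝ≥0∞) ≤ X N A ω := by
  rw [X, visits_eq_iSup _ _ (u := []) trivial, ← ENat.toENNReal_coe, ENat.toENNReal_le]
  exact le_iSup (fun m => (cutVisits (fun w => N w ω) (fun w => A w ω) m [] : ℕ∞)) m

theorem toMeasure_two_le_ne_zero (hμ : μ 0 + μ 1 < 1) : μ.toMeasure {a | 2 ≤ a} ≠ 0 := by
  intro h0
  have h1 : (1 : ℝ≥0∞) = μ.toMeasure (({0, 1} : Finset ℕ) ∪ {a | 2 ≤ a}) := by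
    rw [show ((({0, 1} : Finset ℕ) : Set ℕ) ∪ {a | 2 ≤ a}) = Set.univ by
      ext a; simp; omega, measure_univ]
  have h2 := measure_union_le (μ := μ.toMeasure) (({0, 1} : Finset ℕ) : Set ℕ) {a | 2 ≤ a}
  rw [← h1, h0, add_zero, PMF.toMeasure_apply_finset, Finset.sum_pair (by simp)] at h2
  exact absurd hμ (not_lt.2 h2)

/-- The increments bounded below in `IsModel.lintegral_cutVisits_succ` telescope, and their sum
stays below the finite mean of X. -/
theorem IsModel.tsum_lintegral_linkedSum_ne_top [IsProbabilityMeasure P] (h : IsModel P q μ N A)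
    (hμ : μ 0 + μ 1 < 1) (hsub : IsSubcritical P N A) :
    ∑' m, ∫⁻ ω, linkedSum (fun w => N w ω) (fun w => A w ω) (fun _ => 1) m [] ∂P ≠ ∞ := by
  have hc : ENNReal.ofReal q * μ.toMeasure {a | 2 ≤ a} ≠ 0 :=
    mul_ne_zero (by simpa using h.pos) (toMeasure_two_le_ne_zero hμ)
  have hle : ENNReal.ofReal q * μ.toMeasure {a | 2 ≤ a} *
      ∑' m, ∫⁻ ω, linkedSum (fun w => N w ω) (fun w => A w ω) (fun _ => 1) m [] ∂P ≤
        ∫⁻ ω, X N A ω ∂P := by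
    rw [← ENNReal.tsum_mul_left, ENNReal.tsum_eq_iSup_nat]
    refine iSup_le fun M => ?_
    refine le_trans ?_ (lintegral_mono fun ω => cutVisits_le_X M ω)
    induction M with
    | zero => simp
    | succ M ih =>
      rw [Finset.sum_range_succ]
      exact (add_le_add_left ih _).trans (h.lintegral_cutVisits_succ M)
  intro htop
  rw [htop, ENNReal.mul_top hc] at hle
  exact absurd hsub (not_lt.2 hle)

/-- A Borel–Cantelli argument: the numbers of linked vertices are integers with a finite expected
total, hence almost surely they are eventually zero. -/
theorem IsModel.ae_not_hasPath [IsProbabilityMeasure P] (h : IsModel P q μ N A)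
    (hμ : μ 0 + μ 1 < 1) (hsub : IsSubcritical P N A) :
    ∀ᵐ ω ∂P, ∀ᶠ m in Filter.atTop, ¬ HasPath (fun w => N w ω) (fun w => A w ω) m m [] := by
  have hmeas : ∀ m, Measurable fun ω =>
      (linkedSum (fun w => N w ω) (fun w => A w ω) (fun _ => 1) m [] : ℝ≥0∞) := fun m =>
    measurable_from_top.comp (h.measurable_linkedSum [] m fun _ => measurable_const)
  have h1 := h.tsum_lintegral_linkedSum_ne_top hμ hsub
  rw [← lintegral_tsum fun m => (hmeas m).aemeasurable] at h1
  filter_upwards [ae_lt_top (Measurable.tsum hmeas) h1] with ω hω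
  have h2 := ENNReal.tendsto_atTop_zero_of_tsum_ne_top hω.ne
  filter_upwards [h2.eventually (gt_mem_nhds one_pos)] with m hm
  refine not_hasPath_of_linkedSum_eq_zero ?_
  have : linkedSum (fun w => N w ω) (fun w => A w ω) (fun _ => 1) m [] < 1 := by exact_mod_cast hm
  omega

/-- If cars arrive on all vertices, all vertices are linked to the root, and their mean number
at a given height is at least one in the supercritical case. -/
theorem IsModel.one_le_lintegral_linkedSum [IsProbabilityMeasure P] (h : IsModel P q μ N A)
    (hq : 1 / 2 < q) (h0 : μ 0 = 0) (m : ℕ) (u : Vertex) :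
    1 ≤ ∫⁻ ω, linkedSum (fun w => N w ω) (fun w => A w ω) (fun _ => 1) m u ∂P := by
  have hA : ∀ᵐ ω ∂P, ∀ w, 1 ≤ A w ω := by
    rw [ae_all_iff]
    intro w
    rw [ae_iff, ← h0, ← h.arrivals_law w 0]
    congr 1; ext ω; simp
  have hq0 := h.pos
  have hq1 := h.lt_one
  induction m generalizing u with
  | zero =>
    rw [lintegral_congr_ae (g := fun _ => 1)]
    · simp
    · filter_upwards [hA] with ω hω
      simp [linkedSum, hω u]
  | succ m ih =>
    have hmeas : ∀ i, Measurable fun ω =>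
        (linkedSum (fun w => N w ω) (fun w => A w ω) (fun _ => 1) m (i :: u) : ℝ≥0∞) := fun i =>
      measurable_from_top.comp (h.measurable_linkedSum _ m fun _ => measurable_const)
    have hE : ∀ i, MeasurableSet[sigmaOf N A {Sum.inl u}] {ω | i + 1 ≤ N u ω} := fun i =>
      measurableSet_le measurable_const (measurable_sigmaOf_inl (by simp))
    have h1 : ∫⁻ ω, linkedSum (fun w => N w ω) (fun w => A w ω) (fun _ => 1) (m + 1) u ∂P =
        ∑' i, ∫⁻ ω, {ω | i + 1 ≤ N u ω}.indicator (fun _ => 1) ω *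
          linkedSum (fun w => N w ω) (fun w => A w ω) (fun _ => 1) m (i :: u) ∂P := by
      have hprod : ∀ i, Measurable fun ω => {ω | i + 1 ≤ N u ω}.indicator (fun _ => 1) ω *
          (linkedSum (fun w => N w ω) (fun w => A w ω) (fun _ => 1) m (i :: u) : ℝ≥0∞) :=
        fun i => (measurable_const.indicator (h.sigmaOf_le _ _ (hE i))).mul (hmeas i)
      rw [← lintegral_tsum fun i => (hprod i).aemeasurable]
      refine lintegral_congr_ae ?_
      filter_upwards [hA] with ω hω
      rw [linkedSum, if_pos ((hω u).trans (le_cutVisits _ (fun w => A w ω) _ u)),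
        natCast_sum_range_eq_tsum]
      refine tsum_congr fun i => ?_
      simp [Set.indicator]
    have h2 : ∀ i, ENNReal.ofReal (q ^ (i + 1)) ≤
        ∫⁻ ω, {ω | i + 1 ≤ N u ω}.indicator (fun _ => 1) ω *
          linkedSum (fun w => N w ω) (fun w => A w ω) (fun _ => 1) m (i :: u) ∂P := by
      intro i
      rw [lintegral_mul_eq_lintegral_mul_lintegral_of_independent_measurableSpace
        (h.sigmaOf_le {Sum.inl u}) (h.sigmaOf_le (below (i :: u)))
        (h.indep_sigmaOf ?_) (measurable_const.indicator (hE i)) ?_,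
        lintegral_indicator (h.sigmaOf_le _ _ (hE i)), setLIntegral_const, one_mul,
        h.measure_le_offspring]
      · exact le_mul_of_one_le_right' (ih _)
      · rw [Set.disjoint_singleton_left]
        intro hs
        have := List.IsSuffix.length_le (show i :: u <:+ u from hs)
        simp at this
      · refine measurable_from_top.comp (Parking.measurable_linkedSum ?_ ?_
          fun _ => measurable_const)
        · exact fun w hw _ => measurable_sigmaOf_inl hw
        · exact fun w hw _ => measurable_sigmaOf_inr hw
    rw [h1]
    -- The lower bounds add up to the mean offspring number q/(1 - q), which is at least one as q >
    -- 1/2.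
    refine le_trans ?_ (ENNReal.tsum_le_tsum h2)
    rw [← ENNReal.ofReal_tsum_of_nonneg (fun i => by positivity)
      ((summable_nat_add_iff 1).2 (summable_geometric_of_lt_one hq0.le hq1))]
    simp only [pow_succ]
    rw [tsum_mul_right, tsum_geometric_of_lt_one hq0.le hq1, ENNReal.one_le_ofReal,
      inv_mul_eq_div, le_div_iff₀ (by linarith)]
    linarith

/-- If every vertex received a car, the mean numbers of linked vertices would stay at least one,
although they are summable. -/
theorem IsModel.zero_mem_support [IsProbabilityMeasure P] (h : IsModel P q μ N A)
    (hq : 1 / 2 < q) (hμ : μ 0 + μ 1 < 1) (hsub : IsSubcritical P N A) : μ 0 ≠ 0 := by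
  intro h0
  have h1 := ENNReal.tendsto_atTop_zero_of_tsum_ne_top (h.tsum_lintegral_linkedSum_ne_top hμ hsub)
  obtain ⟨m, hm⟩ := (h1.eventually (gt_mem_nhds one_pos)).exists
  exact absurd hm (not_lt.2 (h.one_le_lintegral_linkedSum hq h0 m []))

/-- The subtrees of all vertices have the same law. -/
theorem IsModel.measure_not_isOccupied [IsProbabilityMeasure P] (h : IsModel P q μ N A)
    (u : Vertex) :
    P {ω | ¬ IsOccupied (fun w => N w ω) (fun w => A w ω) u} =
      P {ω | ¬ IsOccupied (fun w => N w ω) (fun w => A w ω) []} := by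
  let Z : Vertex ⊕ Vertex → Ω → ℕ := Sum.elim N A
  have hZ : ∀ s, Measurable (Z s) := by
    rintro (s | s)
    · exact h.measurable_offspring s
    · exact h.measurable_arrivals s
  have hlaw : ∀ (v : Vertex) (s : Vertex ⊕ Vertex),
      Measure.map (Z (Sum.map (· ++ v) (· ++ v) s)) P = Measure.map (Z s) P := by
    intro v s
    refine Measure.ext_of_singleton fun j => ?_
    rw [Measure.map_apply (hZ _) (measurableSet_singleton j),
      Measure.map_apply (hZ _) (measurableSet_singleton j)]
    rcases s with s | s
    · exact (h.offspring_law _ j).trans (h.offspring_law _ j).symm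
    · exact (h.arrivals_law _ j).trans (h.arrivals_law _ j).symm
  have hinj : ∀ v : Vertex, Function.Injective (Sum.map (· ++ v) (· ++ v) :
      Vertex ⊕ Vertex → Vertex ⊕ Vertex) := fun v =>
    Function.Injective.sumMap (List.append_left_injective v) (List.append_left_injective v)
  -- The family seen from `u` and the family seen from the root are both independent with the same
  -- marginals, so they have the same product law.
  have hshift : Measure.map (fun ω s => Z (Sum.map (· ++ u) (· ++ u) s) ω) P =
      Measure.map (fun ω s => Z s ω) P := by
    rw [(iIndepFun_iff_map_fun_eq_infinitePi_map fun s => hZ _).1 (h.indep.precomp (hinj u)),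
      (iIndepFun_iff_map_fun_eq_infinitePi_map hZ).1 h.indep]
    simp only [hlaw]
  let S : Set (Vertex ⊕ Vertex → ℕ) :=
    {z | ¬ IsOccupied (fun w => z (Sum.inl w)) (fun w => z (Sum.inr w)) []}
  have hS : MeasurableSet S :=
    (measurableSet_isOccupied (N := fun w (z : Vertex ⊕ Vertex → ℕ) => z (Sum.inl w))
      (A := fun w z => z (Sum.inr w)) (u := [])
      (fun w _ => measurable_pi_apply _) fun w _ => measurable_pi_apply _).compl
  have h1 := congrArg (fun ν => ν S) hshift
  rw [Measure.map_apply (measurable_pi_lambda _ fun s => hZ _) hS,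
    Measure.map_apply (measurable_pi_lambda _ hZ) hS] at h1
  refine Eq.trans ?_ h1
  congr 1
  ext ω
  simp only [IsOccupied, Set.mem_ofPred_eq, S, Set.mem_preimage, Sum.map_inl, Sum.elim_inl,
    Sum.map_inr, Sum.elim_inr]
  rw [not_iff_not]
  refine exists_congr fun m => ?_
  have := cutVisits_append (fun w => N w ω) (fun w => A w ω) m u []
  rw [List.nil_append] at this
  rw [this]

end Model

/-! ### Decomposition of a cluster over the children -/

open Classical in
/-- The clusters of the occupied vertices among the children `j, …, j + n - 1` of `u` are the
finite trees `cs`. -/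
def ChildClusters (N A : Vertex → ℕ) (u : Vertex) (j n : ℕ) (cs : List CarTree) : Prop :=
  List.Forall₂ (fun i c => IsCluster N A (i :: u) c)
    ((List.range' j n).filter fun i => IsOccupied N A (i :: u)) cs

theorem isCluster_node_iff_childClusters {N A : Vertex → ℕ} {u : Vertex} {a : ℕ}
    {cs : List CarTree} :
    IsCluster N A u (.node a cs) ↔ A u = a ∧ ChildClusters N A u 0 (N u) cs := by
  rw [isCluster_node_iff, occupiedChildren, List.range_eq_range']
  rfl

theorem childClusters_zero_nil {N A : Vertex → ℕ} {u : Vertex} {j : ℕ} :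
    ChildClusters N A u j 0 [] := by
  simp [ChildClusters]

theorem not_childClusters_zero_cons {N A : Vertex → ℕ} {u : Vertex} {j : ℕ} {c : CarTree}
    {cs : List CarTree} : ¬ ChildClusters N A u j 0 (c :: cs) := by
  simp [ChildClusters]

theorem childClusters_succ_nil {N A : Vertex → ℕ} {u : Vertex} {j n : ℕ} :
    ChildClusters N A u j (n + 1) [] ↔
      ¬ IsOccupied N A (j :: u) ∧ ChildClusters N A u (j + 1) n [] := by
  rw [ChildClusters, ChildClusters, List.range'_succ]
  by_cases h : IsOccupied N A (j :: u)
  · simp [h]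
  · simp [h]

theorem childClusters_succ_cons {N A : Vertex → ℕ} {u : Vertex} {j n : ℕ} {c : CarTree}
    {cs : List CarTree} :
    ChildClusters N A u j (n + 1) (c :: cs) ↔
      (¬ IsOccupied N A (j :: u) ∧ ChildClusters N A u (j + 1) n (c :: cs)) ∨
      ((IsOccupied N A (j :: u) ∧ IsCluster N A (j :: u) c) ∧
        ChildClusters N A u (j + 1) n cs) := by
  rw [ChildClusters, ChildClusters, ChildClusters, List.range'_succ]
  by_cases h : IsOccupied N A (j :: u)
  · simp [h]
  · simp [h]

section Measurability

variable {Ω : Type*} {mΩ : MeasurableSpace Ω}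

theorem measurableSet_childClusters {N A : Vertex → Ω → ℕ} {u : Vertex} {j n : ℕ}
    {cs : List CarTree}
    (hocc : ∀ i ≥ j, MeasurableSet {ω | IsOccupied (fun w => N w ω) (fun w => A w ω) (i :: u)})
    (hcl : ∀ i ≥ j, ∀ c ∈ cs,
      MeasurableSet {ω | IsCluster (fun w => N w ω) (fun w => A w ω) (i :: u) c}) :
    MeasurableSet {ω | ChildClusters (fun w => N w ω) (fun w => A w ω) u j n cs} := by
  induction n generalizing j cs with
  | zero =>
    cases cs with
    | nil => simp [childClusters_zero_nil]
    | cons c cs => simp [not_childClusters_zero_cons]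
  | succ n ih =>
    have ih' : ∀ cs', cs' ⊆ cs → MeasurableSet
        {ω | ChildClusters (fun w => N w ω) (fun w => A w ω) u (j + 1) n cs'} := fun cs' h =>
      ih (fun i hi => hocc i (by omega)) fun i hi c hc => hcl i (by omega) c (h hc)
    cases cs with
    | nil =>
      simp only [childClusters_succ_nil]
      exact (hocc j le_rfl).compl.inter (ih' _ (List.Subset.refl _))
    | cons c cs =>
      simp only [childClusters_succ_cons]
      exact ((hocc j le_rfl).compl.inter (ih' _ (List.Subset.refl _))).union
        (((hocc j le_rfl).inter (hcl j le_rfl c (by simp))).inter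
          (ih' _ (List.subset_cons_self _ _)))

theorem setOf_isCluster_node {N A : Vertex → Ω → ℕ} {u : Vertex} {a : ℕ} {cs : List CarTree} :
    {ω | IsCluster (fun w => N w ω) (fun w => A w ω) u (.node a cs)} =
      {ω | A u ω = a} ∩ ⋃ n, ({ω | N u ω = n} ∩
        {ω | ChildClusters (fun w => N w ω) (fun w => A w ω) u 0 n cs}) := by
  ext ω
  simp [isCluster_node_iff_childClusters]

theorem measurableSet_isCluster {N A : Vertex → Ω → ℕ} {u : Vertex}
    (hN : ∀ w, u <:+ w → Measurable (N w)) (hA : ∀ w, u <:+ w → Measurable (A w))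
    (t : CarTree) : MeasurableSet {ω | IsCluster (fun w => N w ω) (fun w => A w ω) u t} := by
  induction t using CarTree.induction generalizing u with
  | node a cs ih =>
    rw [setOf_isCluster_node]
    refine (hA u List.suffix_rfl (measurableSet_singleton a)).inter
      (MeasurableSet.iUnion fun n => (hN u List.suffix_rfl (measurableSet_singleton n)).inter
        (measurableSet_childClusters (fun i _ => ?_) fun i _ c hc => ih c hc ?_ ?_))
    · exact measurableSet_isOccupied (fun w hw => hN w ((List.suffix_cons i u).trans hw))
        fun w hw => hA w ((List.suffix_cons i u).trans hw)
    · exact fun w hw => hN w ((List.suffix_cons i u).trans hw)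
    · exact fun w hw => hA w ((List.suffix_cons i u).trans hw)

end Measurability

/-- Indices of the variables attached to the descendants of the children `j, j + 1, …` of `u`. -/
def belowFrom (u : Vertex) (j : ℕ) : Set (Vertex ⊕ Vertex) := {s | ∃ i ≥ j, s ∈ below (i :: u)}

theorem eq_of_mem_below {u : Vertex} {i j : ℕ} {s : Vertex ⊕ Vertex} (hi : s ∈ below (i :: u))
    (hj : s ∈ below (j :: u)) : i = j := by
  have key : ∀ w : Vertex, i :: u <:+ w → j :: u <:+ w → i = j := by
    intro w h1 h2
    have h3 := (List.suffix_of_suffix_length_le h1 h2 (by simp)).eq_of_length (by simp)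
    exact (List.cons.inj h3).1
  rcases s with w | w
  · exact key w hi hj
  · exact key w hi hj

theorem disjoint_below_belowFrom (u : Vertex) (j : ℕ) :
    Disjoint (below (j :: u)) (belowFrom u (j + 1)) := by
  rw [Set.disjoint_left]
  rintro s hs ⟨i, hi, hsi⟩
  have := eq_of_mem_below hs hsi
  omega

theorem inl_notMem_belowFrom (u : Vertex) (j : ℕ) : Sum.inl u ∉ belowFrom u j := by
  rintro ⟨i, _, hs⟩
  have := List.IsSuffix.length_le (show i :: u <:+ u from hs)
  simp at this

theorem inr_notMem_belowFrom (u : Vertex) (j : ℕ) : Sum.inr u ∉ belowFrom u j := by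
  rintro ⟨i, _, hs⟩
  have := List.IsSuffix.length_le (show i :: u <:+ u from hs)
  simp at this

/-! ### Summation over the geometric number of children -/

/-- Sum over the ways of distributing the trees `cs` among `n` children, with a factor `p` for each
child without a tree and a factor `f c` for each tree `c`. -/
noncomputable def slotSum (p : ℝ≥0∞) (f : CarTree → ℝ≥0∞) : ℕ → List CarTree → ℝ≥0∞
  | 0, [] => 1
  | 0, _ :: _ => 0
  | n + 1, [] => p * slotSum p f n []
  | n + 1, c :: cs => p * slotSum p f n (c :: cs) + f c * slotSum p f n cs

/-- Finiteness of `G` matters: for r > 0, the value ∞ also solves the equation. -/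
theorem eq_mul_inv_of_eq_add_mul {G b r : ℝ≥0∞} (hG : G ≠ ∞) (hr : r < 1)
    (h : G = b + r * G) : G = b * (1 - r)⁻¹ := by
  have h1 : (1 - r) * G = b := by
    rw [ENNReal.sub_mul fun _ _ => hG, one_mul]
    exact ENNReal.sub_eq_of_eq_add (ENNReal.mul_ne_top (hr.trans ENNReal.one_lt_top).ne hG) h
  rw [← div_eq_mul_inv]
  refine (ENNReal.eq_div_iff (tsub_pos_of_lt hr).ne' ?_).2 h1
  exact (tsub_le_self.trans_lt ENNReal.one_lt_top).ne

/-- Removing the first child shifts `n` by one and costs a factor `q`, so the geometric weights turn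
the slot recursion into a linear equation for the sum. Finiteness is requested for every suffix
because the induction consumes `cs` from the left; in the application these sums are probabilities.
-/
theorem tsum_slotSum {p q b : ℝ≥0∞} {f : CarTree → ℝ≥0∞} {cs : List CarTree}
    (hpq : q * p < 1) (hfin : ∀ cs', cs' <:+ cs → ∑' n, q ^ n * b * slotSum p f n cs' ≠ ∞) :
    ∑' n, q ^ n * b * slotSum p f n cs =
      b * (1 - q * p)⁻¹ * (cs.map fun c => q * f c * (1 - q * p)⁻¹).prod := by
  induction cs with
  | nil =>
    rw [List.map_nil, List.prod_nil, mul_one]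
    refine eq_mul_inv_of_eq_add_mul (hfin [] List.suffix_rfl) hpq ?_
    conv_lhs => rw [tsum_eq_zero_add' ENNReal.summable]
    rw [← ENNReal.tsum_mul_left]
    congr 1
    · simp [slotSum]
    · refine tsum_congr fun n => ?_
      rw [slotSum]; ring
  | cons c cs ih =>
    have h1 : ∑' n, q ^ n * b * slotSum p f n (c :: cs) =
        q * f c * ∑' n, q ^ n * b * slotSum p f n cs +
          q * p * ∑' n, q ^ n * b * slotSum p f n (c :: cs) := by
      conv_lhs => rw [tsum_eq_zero_add' ENNReal.summable]
      rw [← ENNReal.tsum_mul_left, ← ENNReal.tsum_mul_left, ← ENNReal.tsum_add]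
      rw [slotSum, mul_zero, zero_add]
      refine tsum_congr fun n => ?_
      rw [slotSum]; ring
    rw [eq_mul_inv_of_eq_add_mul (hfin _ List.suffix_rfl) hpq h1,
      ih fun cs' h => hfin cs' (h.trans (List.suffix_cons c cs)), List.map_cons, List.prod_cons]
    ring

/-! ### Law of the cluster of a vertex -/

section Model

variable {Ω : Type*} {mΩ : MeasurableSpace Ω} {P : Measure Ω} {q : ℝ} {μ : PMF ℕ}
  {N A : Vertex → Ω → ℕ}

theorem measurableSet_below_isOccupied (u : Vertex) :
    MeasurableSet[sigmaOf N A (below u)]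
      {ω | IsOccupied (fun w => N w ω) (fun w => A w ω) u} :=
  measurableSet_isOccupied (fun _ hw => measurable_sigmaOf_inl hw)
    fun _ hw => measurable_sigmaOf_inr hw

theorem measurableSet_below_isCluster (u : Vertex) (t : CarTree) :
    MeasurableSet[sigmaOf N A (below u)]
      {ω | IsCluster (fun w => N w ω) (fun w => A w ω) u t} :=
  measurableSet_isCluster (fun _ hw => measurable_sigmaOf_inl hw)
    (fun _ hw => measurable_sigmaOf_inr hw) t

theorem sigmaOf_mono {I J : Set (Vertex ⊕ Vertex)} (h : I ⊆ J) : sigmaOf N A I ≤ sigmaOf N A J :=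
  biSup_mono h

theorem below_subset_belowFrom {u : Vertex} {i j : ℕ} (h : j ≤ i) :
    below (i :: u) ⊆ belowFrom u j := fun _ hs => ⟨i, h, hs⟩

theorem measurableSet_belowFrom_childClusters (u : Vertex) (j n : ℕ) (cs : List CarTree) :
    MeasurableSet[sigmaOf N A (belowFrom u j)]
      {ω | ChildClusters (fun w => N w ω) (fun w => A w ω) u j n cs} :=
  measurableSet_childClusters
    (fun i hi => sigmaOf_mono (below_subset_belowFrom hi) _ (measurableSet_below_isOccupied (i :: u)))
    fun i hi c _ =>
      sigmaOf_mono (below_subset_belowFrom hi) _ (measurableSet_below_isCluster (i :: u) c)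

/-- The first child and the later ones depend on disjoint families of variables, so the
probabilities obey the recursion defining `slotSum`. -/
theorem IsModel.measure_childClusters [IsProbabilityMeasure P] (h : IsModel P q μ N A)
    {f : CarTree → ℝ≥0∞} {u : Vertex} {cs : List CarTree} (hfull : ∀ c ∈ cs, c.IsFull)
    (hf : ∀ i, ∀ c ∈ cs,
      P {ω | IsCluster (fun w => N w ω) (fun w => A w ω) (i :: u) c} = f c) (n j : ℕ) :
    P {ω | ChildClusters (fun w => N w ω) (fun w => A w ω) u j n cs} =
      slotSum (P {ω | ¬ IsOccupied (fun w => N w ω) (fun w => A w ω) []}) f n cs := by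
  induction n generalizing j cs with
  | zero =>
    cases cs with
    | nil => simp [childClusters_zero_nil, slotSum]
    | cons c cs => simp [not_childClusters_zero_cons, slotSum]
  | succ n ih =>
    have hwhite : ∀ cs', cs' ⊆ cs →
        P ({ω | ¬ IsOccupied (fun w => N w ω) (fun w => A w ω) (j :: u)} ∩
          {ω | ChildClusters (fun w => N w ω) (fun w => A w ω) u (j + 1) n cs'}) =
        P {ω | ¬ IsOccupied (fun w => N w ω) (fun w => A w ω) []} *
          slotSum (P {ω | ¬ IsOccupied (fun w => N w ω) (fun w => A w ω) []}) f n cs' := by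
      intro cs' hcs
      rw [h.measure_inter (disjoint_below_belowFrom u j)
        (s := {ω | ¬ IsOccupied (fun w => N w ω) (fun w => A w ω) (j :: u)})
        (measurableSet_below_isOccupied (j :: u)).compl
        (measurableSet_belowFrom_childClusters u (j + 1) n cs'), h.measure_not_isOccupied,
        ih (fun c hc => hfull c (hcs hc)) fun i c hc => hf i c (hcs hc)]
    cases cs with
    | nil =>
      simp only [childClusters_succ_nil]
      rw [slotSum]
      exact hwhite [] (List.Subset.refl _)
    | cons c cs =>
      -- Occupation of the child need not be recorded beside its cluster `c`: a full `c` implies it.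
      have hset : {ω | ChildClusters (fun w => N w ω) (fun w => A w ω) u j (n + 1) (c :: cs)} =
          ({ω | ¬ IsOccupied (fun w => N w ω) (fun w => A w ω) (j :: u)} ∩
            {ω | ChildClusters (fun w => N w ω) (fun w => A w ω) u (j + 1) n (c :: cs)}) ∪
          ({ω | IsCluster (fun w => N w ω) (fun w => A w ω) (j :: u) c} ∩
            {ω | ChildClusters (fun w => N w ω) (fun w => A w ω) u (j + 1) n cs}) := by
        ext ω
        simp only [childClusters_succ_cons]
        refine or_congr Iff.rfl (and_congr_left fun _ => and_iff_right_of_imp fun hc => ?_)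
        exact hc.isOccupied_iff.2 (hfull c (by simp)).one_le
      rw [hset, measure_union, hwhite _ (List.Subset.refl _), slotSum,
        h.measure_inter (disjoint_below_belowFrom u j)
          (measurableSet_below_isCluster (j :: u) c)
          (measurableSet_belowFrom_childClusters u (j + 1) n cs), hf j c (by simp),
        ih (fun c hc => hfull c (by simp [hc])) fun i c hc => hf i c (by simp [hc])]
      · rw [Set.disjoint_left]
        rintro ω ⟨h1, _⟩ ⟨h2, _⟩
        exact h1 (h2.isOccupied_iff.2 (hfull c (by simp)).one_le)
      · exact (h.sigmaOf_le _ _ (measurableSet_below_isCluster (j :: u) c)).inter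
          (h.sigmaOf_le _ _ (measurableSet_belowFrom_childClusters u (j + 1) n cs))

theorem IsModel.measure_iUnion_childClusters [IsProbabilityMeasure P] (h : IsModel P q μ N A)
    {f : CarTree → ℝ≥0∞} {u : Vertex} {cs : List CarTree} (hfull : ∀ c ∈ cs, c.IsFull)
    (hf : ∀ i, ∀ c ∈ cs,
      P {ω | IsCluster (fun w => N w ω) (fun w => A w ω) (i :: u) c} = f c) :
    P (⋃ n, ({ω | N u ω = n} ∩
        {ω | ChildClusters (fun w => N w ω) (fun w => A w ω) u 0 n cs})) =
      ∑' n, ENNReal.ofReal q ^ n * ENNReal.ofReal (1 - q) *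
        slotSum (P {ω | ¬ IsOccupied (fun w => N w ω) (fun w => A w ω) []}) f n cs := by
  have hNm : ∀ n, MeasurableSet[sigmaOf N A {Sum.inl u}] {ω | N u ω = n} := fun n =>
    (measurable_sigmaOf_inl (by simp)) (measurableSet_singleton n)
  rw [measure_iUnion]
  · refine tsum_congr fun n => ?_
    rw [h.measure_inter (Set.disjoint_singleton_left.2 (inl_notMem_belowFrom u 0)) (hNm n)
      (measurableSet_belowFrom_childClusters u 0 n cs), h.offspring_law,
      h.measure_childClusters hfull hf, ENNReal.ofReal_mul (pow_nonneg h.pos.le n),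
      ENNReal.ofReal_pow h.pos.le]
  · intro m n hmn
    rw [Function.onFun, Set.disjoint_left]
    rintro ω ⟨h1, _⟩ ⟨h2, _⟩
    exact hmn (Eq.trans (Eq.symm h1) h2)
  · exact fun n => (h.sigmaOf_le _ _ (hNm n)).inter
      (h.sigmaOf_le _ _ (measurableSet_belowFrom_childClusters u 0 n cs))

theorem prod_pow_size_mul_weight (x : ℝ≥0∞) (cs : List CarTree) :
    (cs.map fun c => x ^ c.size * c.weight μ).prod =
      x ^ (cs.map CarTree.size).sum * (cs.map (CarTree.weight μ)).prod := by
  induction cs with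
  | nil => simp
  | cons c cs ih =>
    simp only [List.map_cons, List.prod_cons, List.sum_cons, ih, pow_add]
    ring

/-- Law of the cluster of a vertex. -/
theorem IsModel.measure_isCluster [IsProbabilityMeasure P] (h : IsModel P q μ N A)
    {p x K : ℝ≥0∞}
    (hp : P {ω | ¬ IsOccupied (fun w => N w ω) (fun w => A w ω) []} = p)
    (hx : K * x = ENNReal.ofReal (1 - q) * (1 - ENNReal.ofReal q * p)⁻¹)
    (hK : ENNReal.ofReal q * K * (1 - ENNReal.ofReal q * p)⁻¹ = 1)
    {t : CarTree} (ht : t.IsFull) (u : Vertex) :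
    P {ω | IsCluster (fun w => N w ω) (fun w => A w ω) u t} = K * x ^ t.size * t.weight μ := by
  have hpq : ENNReal.ofReal q * p < 1 := by
    have h1 : p ≤ 1 := hp ▸ prob_le_one
    calc ENNReal.ofReal q * p ≤ ENNReal.ofReal q := mul_le_of_le_one_right' h1
      _ < 1 := by rw [ENNReal.ofReal_lt_one]; exact h.lt_one
  induction t using CarTree.induction generalizing u with
  | node a cs ih =>
    have hfull := (CarTree.isFull_node.1 ht).2
    have hf : ∀ i, ∀ c ∈ cs, P {ω | IsCluster (fun w => N w ω) (fun w => A w ω) (i :: u) c} =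
        K * x ^ c.size * c.weight μ := fun i c hc => ih c hc (hfull c hc) (i :: u)
    have hsum : ∀ cs', cs' <:+ cs → P (⋃ n, ({ω | N u ω = n} ∩
        {ω | ChildClusters (fun w => N w ω) (fun w => A w ω) u 0 n cs'})) =
        ∑' n, ENNReal.ofReal q ^ n * ENNReal.ofReal (1 - q) *
          slotSum p (fun c => K * x ^ c.size * c.weight μ) n cs' := by
      intro cs' hcs
      rw [h.measure_iUnion_childClusters (fun c hc => hfull c (hcs.subset hc))
        fun i c hc => hf i c (hcs.subset hc), hp]
    have hmeas : MeasurableSet[sigmaOf N A ({Sum.inl u} ∪ belowFrom u 0)]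
        (⋃ n, ({ω | N u ω = n} ∩
          {ω | ChildClusters (fun w => N w ω) (fun w => A w ω) u 0 n cs})) := by
      refine MeasurableSet.iUnion fun n => MeasurableSet.inter ?_ ?_
      · exact (measurable_sigmaOf_inl (by simp)) (measurableSet_singleton n)
      · exact sigmaOf_mono Set.subset_union_right _
          (measurableSet_belowFrom_childClusters u 0 n cs)
    have hlaw : P {ω | A u ω = a} = μ a := h.arrivals_law u a
    have hA : MeasurableSet[sigmaOf N A {Sum.inr u}] {ω | A u ω = a} :=
      (measurable_sigmaOf_inr (by simp)) (measurableSet_singleton a)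
    rw [setOf_isCluster_node, h.measure_inter (I := {Sum.inr u}) (by
      rw [Set.disjoint_singleton_left]
      rintro (hs | hs)
      · simp at hs
      · exact inr_notMem_belowFrom u 0 hs) hA hmeas,
      hsum cs List.suffix_rfl, tsum_slotSum hpq fun cs' hcs => by
        rw [← hsum cs' hcs]; exact measure_ne_top _ _]
    -- By `hK`, the factor of each child loses its constant K; by `hx`, the remaining factor of the
    -- vertex itself is K x. Together they give K times x to the total size.
    have hprod : (cs.map fun c => ENNReal.ofReal q * (K * x ^ c.size * c.weight μ) *
        (1 - ENNReal.ofReal q * p)⁻¹) = cs.map fun c => x ^ c.size * c.weight μ := by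
      refine List.map_congr_left fun c _ => ?_
      calc _ = ENNReal.ofReal q * K * (1 - ENNReal.ofReal q * p)⁻¹ * (x ^ c.size * c.weight μ) := by
            ring
        _ = _ := by rw [hK, one_mul]
    rw [hprod, prod_pow_size_mul_weight, hlaw, ← hx, CarTree.size, CarTree.weight, pow_add]
    ring

/-! ### Countability of trees, and full trees of positive weight -/

/-- An injective encoding of trees. -/
def CarTree.code : CarTree → ℕ
  | .node a cs => Encodable.encode (a, cs.map CarTree.code)

theorem CarTree.code_injective : Function.Injective CarTree.code := by
  intro s
  induction s using CarTree.induction with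
  | node a cs ih =>
    rintro ⟨b, ds⟩ h
    rw [CarTree.code, CarTree.code, Encodable.encode_inj, Prod.mk.injEq] at h
    obtain ⟨rfl, h⟩ := h
    congr 1
    induction cs generalizing ds with
    | nil => simpa [eq_comm] using h
    | cons c cs ihl =>
      cases ds with
      | nil => simp at h
      | cons d ds =>
        rw [List.map_cons, List.map_cons, List.cons.injEq] at h
        rw [ih c (by simp) h.1, ihl (fun c hc => ih c (by simp [hc])) ds h.2]

instance : Countable CarTree := CarTree.code_injective.countable

end Model

/-- If some vertices receive no car and some receive at least two cars, there are fully parked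
trees of positive weight with any number of outgoing cars. -/
theorem exists_isFull_rootVisits {μ : PMF ℕ} (h0 : μ 0 ≠ 0) {a : ℕ} (ha : 2 ≤ a)
    (hμa : μ a ≠ 0) (k : ℕ) :
    ∃ t : CarTree, t.IsFull ∧ t.rootVisits = k + 1 ∧ t.weight μ ≠ 0 := by
  -- A star whose vertices all receive `a` cars has enough visits; placing it above a new root
  -- without arrivals then lowers the number of visits by exactly one, as often as needed.
  have hbig : ∃ t : CarTree, t.IsFull ∧ k + 1 ≤ t.rootVisits ∧ t.weight μ ≠ 0 := by
    have hleaf : (CarTree.node a []).IsFull :=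
      CarTree.isFull_node.2 ⟨by simp [CarTree.rootVisits]; omega, by simp⟩
    have hle : k + 1 ≤ (CarTree.node a (List.replicate (k + 1) (.node a []))).rootVisits := by
      have : (k + 1) * 1 ≤ (k + 1) * (a - 1) := Nat.mul_le_mul_left _ (by omega)
      simp [CarTree.rootVisits]
      omega
    refine ⟨.node a (List.replicate (k + 1) (.node a [])), CarTree.isFull_node.2 ⟨by omega, ?_⟩,
      hle, ?_⟩
    · intro c hc
      rw [List.eq_of_mem_replicate hc]; exact hleaf
    · simp [CarTree.weight, hμa]
  obtain ⟨t, ht, hk, hw⟩ := hbig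
  obtain ⟨n, hn⟩ := Nat.exists_eq_add_of_le hk
  induction n generalizing t with
  | zero => exact ⟨t, ht, by omega, hw⟩
  | succ n ih =>
    have hv : (CarTree.node 0 [t]).rootVisits = t.rootVisits - 1 := by simp [CarTree.rootVisits]
    refine ih (.node 0 [t]) (CarTree.isFull_node.2 ⟨by omega, by simpa using ht⟩) (by omega) ?_
      (by omega)
    simp [CarTree.weight, h0, hw]

theorem exists_two_le_mem_support {μ : PMF ℕ} (hμ : μ 0 + μ 1 < 1) : ∃ a, 2 ≤ a ∧ μ a ≠ 0 := by
  by_contra! h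
  refine toMeasure_two_le_ne_zero hμ ?_
  rw [PMF.toMeasure_apply_eq_zero_iff _ MeasurableSet.of_discrete, Set.disjoint_right]
  exact fun a ha hs => hs (h a ha)

theorem tsum_fullyParked (k : ℕ) (f : CarTree → ℝ≥0∞) :
    ∑' n : ℕ, ∑' t : fullyParked n k, f t =
      ∑' t : {t : CarTree | t.IsFull ∧ t.rootVisits = k + 1}, f t := by
  have hset : {t : CarTree | t.IsFull ∧ t.rootVisits = k + 1} = ⋃ n, fullyParked n k := by
    ext t
    simp [mem_fullyParked]
  rw [hset, ENNReal.tsum_biUnion]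
  intro m _ n _ hmn
  rw [Function.onFun, Set.disjoint_left]
  intro t h1 h2
  exact hmn ((mem_fullyParked.1 h1).1.symm.trans (mem_fullyParked.1 h2).1)

/-! ### From the cluster to the law of X -/

section Model

variable {Ω : Type*} {mΩ : MeasurableSpace Ω} {P : Measure Ω} {q : ℝ} {μ : PMF ℕ}
  {N A : Vertex → Ω → ℕ}

theorem setOf_X_eq_zero :
    {ω | X N A ω = 0} = {ω | ¬ IsOccupied (fun w => N w ω) (fun w => A w ω) []} := by
  ext ω
  have := one_le_visits_iff (fun w => N w ω) (fun w => A w ω) (u := []) trivial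
  rw [Set.mem_ofPred_eq, Set.mem_ofPred_eq, ← this, X, Order.one_le_iff_ne_zero, not_not]

theorem cluster_eq_some_iff {ω : Ω} {t : CarTree} :
    cluster N A ω = some t ↔ t.IsFull ∧ IsCluster (fun w => N w ω) (fun w => A w ω) [] t := by
  rw [cluster, rootCluster_eq_some_iff]
  constructor
  · exact fun ⟨h1, h2⟩ => ⟨h2.isFull h1, h2⟩
  · exact fun ⟨h1, h2⟩ => ⟨h2.isOccupied_iff.2 h1.one_le, h2⟩

theorem X_eq_of_cluster_eq_some {ω : Ω} {t : CarTree} (h : cluster N A ω = some t) :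
    X N A ω = t.rootVisits :=
  visits_eq_of_eventually _ _ (u := []) trivial (cluster_eq_some_iff.1 h).2.eventually_cutVisits

theorem IsModel.measurableSet_cluster_eq (h : IsModel P q μ N A) (t : CarTree) :
    MeasurableSet {ω | cluster N A ω = some t} := by
  simp only [cluster_eq_some_iff]
  exact (MeasurableSet.const _).inter (measurableSet_isCluster
    (fun w _ => h.measurable_offspring w) (fun w _ => h.measurable_arrivals w) t)

theorem IsModel.ae_exists_cluster_eq [IsProbabilityMeasure P] (h : IsModel P q μ N A)
    (hμ : μ 0 + μ 1 < 1) (hsub : IsSubcritical P N A) :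
    ∀ᵐ ω ∂P, X N A ω ≠ 0 → ∃ t, cluster N A ω = some t := by
  filter_upwards [h.ae_not_hasPath hμ hsub] with ω hω h0
  refine exists_rootCluster_eq_some ?_ hω
  by_contra hocc
  have : ω ∈ {ω | X N A ω = 0} := by rw [setOf_X_eq_zero]; exact hocc
  exact h0 this

/-- An occupied root almost surely has a finite cluster, and this cluster determines X; there are
only countably many trees. -/
theorem IsModel.measure_X_eq [IsProbabilityMeasure P] (h : IsModel P q μ N A)
    (hμ : μ 0 + μ 1 < 1) (hsub : IsSubcritical P N A) (k : ℕ) :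
    P {ω | X N A ω = k + 1} =
      ∑' t : {t : CarTree | t.IsFull ∧ t.rootVisits = k + 1},
        P {ω | cluster N A ω = some (t : CarTree)} := by
  rw [← measure_iUnion]
  · refine measure_congr ?_
    filter_upwards [h.ae_exists_cluster_eq hμ hsub] with ω hω
    refine propext ⟨fun hX => ?_, fun hX => ?_⟩
    · have hX' : X N A ω = k + 1 := hX
      obtain ⟨t, ht⟩ := hω (by rw [hX']; simp)
      refine Set.mem_iUnion.2 ⟨⟨t, (cluster_eq_some_iff.1 ht).1, ?_⟩, ht⟩
      rw [X_eq_of_cluster_eq_some ht] at hX'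
      exact_mod_cast hX'
    · obtain ⟨⟨t, ht⟩, hc⟩ := Set.mem_iUnion.1 hX
      refine (X_eq_of_cluster_eq_some hc).trans ?_
      rw [ht.2]; push_cast; rfl
  · intro s t hst
    rw [Function.onFun, Set.disjoint_left]
    intro ω h1 h2
    exact hst (Subtype.ext (Option.some.inj (Eq.trans (Eq.symm h1) h2)))
  · exact fun t => h.measurableSet_cluster_eq t

theorem IsModel.measurableSet_X_eq (h : IsModel P q μ N A) (v : ℕ∞) :
    MeasurableSet {ω | X N A ω = v} := by
  have hX : Measurable fun ω => (X N A ω : ℝ≥0∞) := by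
    have : (fun ω => (X N A ω : ℝ≥0∞)) =
        fun ω => ⨆ m, (cutVisits (fun w => N w ω) (fun w => A w ω) m [] : ℝ≥0∞) := by
      ext1 ω
      rw [X, visits_eq_iSup _ _ (u := []) trivial, ENat.toENNReal_iSup]
      rfl
    rw [this]
    exact Measurable.iSup fun m => measurable_from_top.comp (h.measurable_cutVisits [] m)
  have hset : {ω | X N A ω = v} = (fun ω => (X N A ω : ℝ≥0∞)) ⁻¹' {(v : ℝ≥0∞)} := by
    ext ω; simp
  rw [hset]
  exact hX (measurableSet_singleton _)

end Model

end Parking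

/-! ### The theorem -/

open Parking in
theorem mainTheorem3 {Ω : Type*} [MeasurableSpace Ω] (P : Measure Ω) [IsProbabilityMeasure P]
    (q : ℝ) (hq : 1 / 2 < q) (hq1 : q < 1) (μ : PMF ℕ) (hμ : μ 0 + μ 1 < 1)
    (N A : Parking.Vertex → Ω → ℕ)
    (hN : ∀ u, Measurable (N u)) (hA : ∀ u, Measurable (A u))
    (hindep : iIndepFun (Sum.elim N A) P)
    (hNlaw : ∀ u j, P {ω | N u ω = j} = ENNReal.ofReal (q ^ j * (1 - q)))
    (hAlaw : ∀ u j, P {ω | A u ω = j} = μ j)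
    (hsub : Parking.IsSubcritical P N A)
    (p : ℝ) (hp : p = P.real {ω | Parking.X N A ω = 0})
    (x : ℝ≥0∞) (hx : x = ENNReal.ofReal (q * (1 - q) / (1 - q * p) ^ 2)) (k : ℕ) :
    P {ω | Parking.X N A ω = k + 1} =
        ENNReal.ofReal ((1 - q * p) / q) * PowerSeries.coeff k (Parking.F μ x) ∧
      Parking.IsBoltzmann (cond P {ω | Parking.X N A ω = k + 1}) (Parking.cluster N A) μ k x := by
  have hq0 : 0 < q := by linarith
  have h : IsModel P q μ N A := ⟨hq0, hq1, hN, hA, hindep, hNlaw, hAlaw⟩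
  have hp0 : 0 ≤ p := hp ▸ measureReal_nonneg
  have hp1 : p ≤ 1 := hp ▸ measureReal_le_one
  have hqp : 0 < 1 - q * p := by nlinarith
  have hinv : (1 - ENNReal.ofReal q * ENNReal.ofReal p)⁻¹ = ENNReal.ofReal (1 - q * p)⁻¹ := by
    rw [ENNReal.ofReal_inv_of_pos hqp, ENNReal.ofReal_sub _ (by positivity), ENNReal.ofReal_one,
      ENNReal.ofReal_mul hq0.le]
  have hpP : P {ω | ¬ IsOccupied (fun w => N w ω) (fun w => A w ω) []} = ENNReal.ofReal p := by
    rw [← setOf_X_eq_zero, hp, ofReal_measureReal]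
  have hlaw : ∀ t : CarTree, t.IsFull → P {ω | cluster N A ω = some t} =
      ENNReal.ofReal ((1 - q * p) / q) * x ^ t.size * t.weight μ := by
    intro t ht
    simp only [cluster_eq_some_iff, ht, true_and]
    -- The two remaining equations, Kx = (1 - q)/(1 - qp) and qK/(1 - qp) = 1, are those which
    -- single out K and x.
    refine h.measure_isCluster hpP ?_ ?_ ht []
    · rw [hinv, hx, ← ENNReal.ofReal_mul (by positivity), ← ENNReal.ofReal_mul (by linarith)]
      congr 1
      field_simp
    · rw [hinv, ← ENNReal.ofReal_mul hq0.le, ← ENNReal.ofReal_mul (by positivity),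
        ENNReal.ofReal_eq_one]
      field_simp
  have hF : PowerSeries.coeff k (F μ x) =
      ∑' t : {t : CarTree | t.IsFull ∧ t.rootVisits = k + 1},
        (t : CarTree).weight μ * x ^ (t : CarTree).size := by
    rw [F, PowerSeries.coeff_mk, ← tsum_fullyParked k fun t => t.weight μ * x ^ t.size]
    refine tsum_congr fun n => tsum_congr fun t => ?_
    rw [(mem_fullyParked.1 t.2).1]
  have hmain : P {ω | X N A ω = k + 1} =
      ENNReal.ofReal ((1 - q * p) / q) * PowerSeries.coeff k (F μ x) := by
    rw [h.measure_X_eq hμ hsub, hF, ← ENNReal.tsum_mul_left]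
    refine tsum_congr fun t => ?_
    rw [hlaw t t.2.1]; ring
  have hK0 : ENNReal.ofReal ((1 - q * p) / q) ≠ 0 := by
    rw [ne_eq, ENNReal.ofReal_eq_zero, not_le]; positivity
  have hx0 : x ≠ 0 := by
    rw [hx, ne_eq, ENNReal.ofReal_eq_zero, not_le]
    have : 0 < 1 - q := by linarith
    positivity
  have hF0 : PowerSeries.coeff k (F μ x) ≠ 0 := by
    obtain ⟨a, ha, hμa⟩ := exists_two_le_mem_support hμ
    obtain ⟨t, ht, htk, hw⟩ := exists_isFull_rootVisits (h.zero_mem_support hq hμ hsub) ha hμa k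
    rw [hF, ne_eq, ENNReal.tsum_eq_zero, not_forall]
    exact ⟨⟨t, ht, htk⟩, mul_ne_zero hw (pow_ne_zero _ hx0)⟩
  -- No analysis of the series is needed: a positive multiple of the coefficient is a probability.
  have hFtop : PowerSeries.coeff k (F μ x) ≠ ∞ := by
    intro htop
    rw [htop, ENNReal.mul_top hK0] at hmain
    exact measure_ne_top P _ hmain
  have hPX : P {ω | X N A ω = k + 1} ≠ 0 := by
    rw [hmain]; exact mul_ne_zero hK0 hF0
  have hmX : MeasurableSet {ω | X N A ω = k + 1} := h.measurableSet_X_eq _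
  refine ⟨hmain, cond_isProbabilityMeasure hPX, h.measurableSet_cluster_eq, hFtop, ?_, ?_⟩
  · filter_upwards [cond_absolutelyContinuous (h.ae_exists_cluster_eq hμ hsub),
      ae_cond_mem hmX] with ω hω hX
    have hX' : X N A ω = k + 1 := hX
    obtain ⟨t, ht⟩ := hω (by rw [hX']; simp)
    refine ⟨t.size, t, mem_fullyParked.2 ⟨rfl, (cluster_eq_some_iff.1 ht).1, ?_⟩, ht⟩
    rw [X_eq_of_cluster_eq_some ht] at hX'
    exact_mod_cast hX'
  · intro n t ht
    obtain ⟨rfl, hfull, hk⟩ := mem_fullyParked.1 ht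
    have hsub' : {ω | cluster N A ω = some t} ⊆ {ω | X N A ω = k + 1} := by
      intro ω hω
      refine (X_eq_of_cluster_eq_some hω).trans ?_
      rw [hk]; push_cast; rfl
    rw [cond_apply hmX, Set.inter_eq_self_of_subset_right hsub', hlaw t hfull, hmain,
      ENNReal.mul_inv (Or.inl hK0) (Or.inl ENNReal.ofReal_ne_top)]
    calc _ = (ENNReal.ofReal ((1 - q * p) / q))⁻¹ * ENNReal.ofReal ((1 - q * p) / q) *
          ((PowerSeries.coeff k (F μ x))⁻¹ * x ^ t.size * t.weight μ) := by ring
      _ = _ := by rw [ENNReal.inv_mul_cancel hK0 ENNReal.ofReal_ne_top, one_mul]
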